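/- Let $G$ be the simply connected five-dimensional nilpotent Lie group whose Lie algebra has a basis $e_1,\dots,e_5$ with the only non-zero brackets $[e_1,e_2]=e_3$, $[e_1,e_3]=-e_5$, $[e_2,e_4]=e_5$ (up to antisymmetry). It is the central extension, by the symplectic form $\omega=-(e^1\wedge e^3-e^2\wedge e^4)$, of the four-dimensional nilpotent group $H$ covering the Kodaira manifold $N$. Let $\Gamma\subset G$ be a discrete cocompact subgroup and let $M=\Gamma\backslash G$; this is the total space of a principal $SO(2)$-bundle over a Kodaira manifold $N$, the fibres being the orbits of $e_5$. The left-invariant frame $e_1,\dots,e_5$ and the dual coframe $e^1,\dots,e^5$ descend to $M$. A generalized almost contact structure on a manifold $M$ is given by smooth tensors $(F,\eta,\pi,\theta,\varphi)$ (a vector field, a 1-form, a bivector field, a 2-form and a $(1,1)$-tensor) such that the endomorphism $$\Phi(X+\alpha)=(\varphi X+\pi^\sharp\alpha)+(\theta^\flat X-\varphi^*\alpha)$$ of $TM\oplus T^*M$, where $\pi^\sharp\alpha=\pi(\alpha,\cdot)$ and $\theta^\flat X=\theta(X,\cdot)$, satisfies $\Phi+\Phi^*=0$ (for the pairing $\langle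 X+\alpha,Y+\beta\rangle=\frac12(\beta(X)+\alpha(Y))$), $\eta(F)=1$, $\Phi(F)=\Phi(\eta)=0$ and $\Phi^2(X+\alpha)=-(X+\alpha)+\eta(X)F+\alpha(F)\eta$. Two such data are identified if $\Phi'=\Phi$, $\eta'=f\eta$, $F'=\frac1fF$ for a smooth function $f$ without zeros. It is a generalized contact structure if the space of smooth sections of the complex bundle $L=\mathbb C F\oplus\{e-i\Phi(e): e\in\ker\eta\oplus\ker F\}$ is closed under the Courant bracket $[\![X+\alpha,Y+\beta]\!]=[X,Y]+\mathcal L_X\beta-\mathcal L_Y\alpha-\frac12d(\beta(X)-\alpha(Y))$. Let $\mathcal J_0$ be the structure on $M$ with $F=e_5$, $\eta=e^5$, $\pi=0$, $\theta=0$, $\varphi=e_2\otimes e^1-e_1\otimes e^2+e_4\otimes e^3-e_3\otimes e^4$ (induced by the complex structure $Je_1=e_2$, $Je_3=e_4$), and let $\mathcal J_1$ be the structure with $F=e_5$, $\eta=e^5$, $\pi=e_1\wedge e_3-e_2\wedge e_4$, $\theta=e^1\wedge e^3-e^2\wedge e^4$, $\varphi=0$. Then $e^5$ is a contact form on $M$,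 and $\mathcal J_1$ is the structure it determines: $\theta=de^5$, $F$ is the Reeb field, $\varphi=0$, and $\pi(\flat X,\flat Y)=\theta(X,Y)$ with $\flat X=\iota_X\theta-\eta(X)\eta$. Moreover $\mathcal J_0$ and $\mathcal J_1$ are in the same deformation family of generalized contact structures: there is a family $(\mathcal J_t)_{t\in\mathbb R}$ of generalized contact structures on $M$, smooth on $\mathbb R\times M$ and real-analytic in $t$, whose members at $t=0$ and $t=1$ are $\mathcal J_0$ and $\mathcal J_1$. -/

import Mathlib

open Bundle Manifold
open scoped ContDiff Topology

noncomputable section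

namespace GenContact

/-! ## Generalized contact structures on a manifold

`M` is a manifold without boundary modelled on the real normed space `E`. -/

section Tensors

variable {E : Type*} [NormedAddCommGroup E] [NormedSpace ℝ E]
  (M : Type*) [TopologicalSpace M] [ChartedSpace E M]

/-- Vector fields on `M` (no smoothness is imposed). -/
abbrev VField := (x : M) → TangentSpace 𝓘(ℝ, E) x

/-- The cotangent space `T*_x M`. -/
abbrev CotSpace {M : Type*} [TopologicalSpace M] [ChartedSpace E M] (x : M) :=
  TangentSpace 𝓘(ℝ, E) x →L[ℝ] ℝ

/-- Differential 1-forms on `M` (no smoothness is imposed). -/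
abbrev OneForm := (x : M) → CotSpace (E := E) x

/-- Sections of `TM ⊕ T*M` (no smoothness is imposed). -/
abbrev GenSection := (x : M) → TangentSpace 𝓘(ℝ, E) x × CotSpace (E := E) x

variable {M}

/-- Smoothness of a vector field. -/
def SmoothVField [IsManifold 𝓘(ℝ, E) ∞ M] (X : VField (E := E) M) : Prop :=
  ContMDiff 𝓘(ℝ, E) (𝓘(ℝ, E).prod 𝓘(ℝ, E)) ∞
    (fun x => TotalSpace.mk' E (E := fun x : M => TangentSpace 𝓘(ℝ, E) x) x (X x))

/-- Smoothness of a 1-form, as a section of the cotangent bundle. -/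
def SmoothOneForm [IsManifold 𝓘(ℝ, E) ∞ M] (α : OneForm (E := E) M) : Prop :=
  ContMDiff 𝓘(ℝ, E) (𝓘(ℝ, E).prod 𝓘(ℝ, E →L[ℝ] ℝ)) ∞
    (fun x => TotalSpace.mk' (E →L[ℝ] ℝ)
      (E := fun x : M => TangentSpace 𝓘(ℝ, E) x →L[ℝ] Bundle.Trivial M ℝ x) x (α x))

/-- Smoothness of a section of `TM ⊕ T*M`. -/
def SmoothGenSection [IsManifold 𝓘(ℝ, E) ∞ M] (s : GenSection (E := E) M) : Prop :=
  SmoothVField (fun x => (s x).1) ∧ SmoothOneForm (fun x => (s x).2)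

/-- The differential `df` of a real function. -/
def dFun (f : M → ℝ) : OneForm (E := E) M := fun x => mvfderiv 𝓘(ℝ, E) f x

/-- The 1-form `α` read in the chart at `x₀`, as a function on `E` with values in `E*`. -/
def chartForm (α : OneForm (E := E) M) (x₀ : M) (y : E) : E →L[ℝ] ℝ :=
  (α ((extChartAt 𝓘(ℝ, E) x₀).symm y)).comp
    (mfderiv 𝓘(ℝ, E) 𝓘(ℝ, E) (extChartAt 𝓘(ℝ, E) x₀).symm y)

/-- The exterior derivative of a 1-form at `x`, computed in the chart at `x`:
`dα (u, v) = u(α(v)) - v(α(u))` for coordinate-constant `u`, `v`.  `dForm α x u` is the covector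
`ι_u dα`. -/
def dForm (α : OneForm (E := E) M) (x : M) :
    TangentSpace 𝓘(ℝ, E) x →L[ℝ] CotSpace (E := E) x :=
  let D : E →L[ℝ] E →L[ℝ] ℝ := fderiv ℝ (chartForm α x) (extChartAt 𝓘(ℝ, E) x x)
  let A : E →L[ℝ] E := mfderiv 𝓘(ℝ, E) 𝓘(ℝ, E) (extChartAt 𝓘(ℝ, E) x) x
  let B : E →L[ℝ] E →L[ℝ] ℝ := (D - D.flip).bilinearComp A A
  B

/-- The Lie derivative of a 1-form along a vector field, `L_X α = d(α(X)) + ι_X dα`. -/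
def lieDer (X : VField (E := E) M) (α : OneForm (E := E) M) : OneForm (E := E) M :=
  fun x => dFun (fun y => α y (X y)) x + dForm α x (X x)

/-- The Courant bracket
`⟦X + α, Y + β⟧ = [X, Y] + L_X β - L_Y α - (1/2) d(β(X) - α(Y))`. -/
def courant (s t : GenSection (E := E) M) : GenSection (E := E) M := fun x =>
  (VectorField.mlieBracket 𝓘(ℝ, E) (fun y => (s y).1) (fun y => (t y).1) x,
    lieDer (fun y => (s y).1) (fun y => (t y).2) x
      - lieDer (fun y => (t y).1) (fun y => (s y).2) x
      - (1 / 2 : ℝ) • dFun (fun y => (t y).2 (s y).1 - (s y).2 (t y).1) x)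

variable (M) in
/-- The tensors `(F, η, π, θ, φ)` of a generalized almost contact structure: a vector field `F`,
a 1-form `η`, a bivector field `π`, given by `π♯ α = π(α, ·)`, a 2-form `θ`, given by
`θ♭ X = θ(X, ·)`, and a `(1,1)`-tensor `φ`.  The conditions are in `IsGenAlmostContact`. -/
@[ext] structure Tensors where
  F : VField (E := E) M
  eta : OneForm (E := E) M
  pi : (x : M) → CotSpace (E := E) x →L[ℝ] TangentSpace 𝓘(ℝ, E) x
  theta : (x : M) → TangentSpace 𝓘(ℝ, E) x →L[ℝ] CotSpace (E := E) x
  phi : (x : M) → TangentSpace 𝓘(ℝ, E) x →L[ℝ] TangentSpace 𝓘(ℝ, E) x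

/-- The endomorphism `Φ (X + α) = (φ X + π♯ α) + (θ♭ X - φ* α)` of `TM ⊕ T*M`. -/
def Tensors.Phi (J : Tensors (E := E) M) (x : M)
    (e : TangentSpace 𝓘(ℝ, E) x × CotSpace (E := E) x) :
    TangentSpace 𝓘(ℝ, E) x × CotSpace (E := E) x :=
  (J.phi x e.1 + J.pi x e.2, J.theta x e.1 - e.2.comp (J.phi x))

/-- The map `α ↦ (X ∧ Y)(α, ·) = α(X) Y - α(Y) X` of the bivector `X ∧ Y`. -/
def sharpWedge {x : M} (X Y : TangentSpace 𝓘(ℝ, E) x) :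
    CotSpace (E := E) x →L[ℝ] TangentSpace 𝓘(ℝ, E) x :=
  let ev (Z : E) : (E →L[ℝ] ℝ) →L[ℝ] ℝ := ContinuousLinearMap.apply ℝ ℝ Z
  let W (X Y : E) : (E →L[ℝ] ℝ) →L[ℝ] E := (ev X).smulRight Y - (ev Y).smulRight X
  W X Y

/-- The map `X ↦ (α ∧ β)(X, ·) = α(X) β - β(X) α` of the 2-form `α ∧ β`. -/
def flatWedge {x : M} (α β : CotSpace (E := E) x) :
    TangentSpace 𝓘(ℝ, E) x →L[ℝ] CotSpace (E := E) x :=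
  α.smulRight β - β.smulRight α

/-- The symmetric pairing `⟨X + α, Y + β⟩ = (1/2) (β(X) + α(Y))`. -/
def pairing {x : M} (e e' : TangentSpace 𝓘(ℝ, E) x × CotSpace (E := E) x) : ℝ :=
  (1 / 2 : ℝ) * (e'.2 e.1 + e.2 e'.1)

/-- A family of tensors `(F, η, π, θ, φ)` with parameter `t ∈ ℝ` is smooth, jointly in the
parameter and the point of the manifold. -/
structure SmoothFamily [IsManifold 𝓘(ℝ, E) ∞ M] (J : ℝ → Tensors (E := E) M) : Prop where
  F : ContMDiff (𝓘(ℝ, ℝ).prod 𝓘(ℝ, E)) (𝓘(ℝ, E).prod 𝓘(ℝ, E)) ∞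
    (fun p : ℝ × M => TotalSpace.mk' E
      (E := fun x : M => TangentSpace 𝓘(ℝ, E) x) p.2 ((J p.1).F p.2))
  eta : ContMDiff (𝓘(ℝ, ℝ).prod 𝓘(ℝ, E)) (𝓘(ℝ, E).prod 𝓘(ℝ, E →L[ℝ] ℝ)) ∞
    (fun p : ℝ × M => TotalSpace.mk' (E →L[ℝ] ℝ)
      (E := fun x : M => TangentSpace 𝓘(ℝ, E) x →L[ℝ] Bundle.Trivial M ℝ x)
      p.2 ((J p.1).eta p.2))
  pi : ContMDiff (𝓘(ℝ, ℝ).prod 𝓘(ℝ, E)) (𝓘(ℝ, E).prod 𝓘(ℝ, (E →L[ℝ] ℝ) →L[ℝ] E)) ∞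
    (fun p : ℝ × M => TotalSpace.mk' ((E →L[ℝ] ℝ) →L[ℝ] E)
      (E := fun x : M => (TangentSpace 𝓘(ℝ, E) x →L[ℝ] Bundle.Trivial M ℝ x) →L[ℝ]
        TangentSpace 𝓘(ℝ, E) x) p.2 ((J p.1).pi p.2))
  theta : ContMDiff (𝓘(ℝ, ℝ).prod 𝓘(ℝ, E)) (𝓘(ℝ, E).prod 𝓘(ℝ, E →L[ℝ] E →L[ℝ] ℝ)) ∞
    (fun p : ℝ × M => TotalSpace.mk' (E →L[ℝ] E →L[ℝ] ℝ)
      (E := fun x : M => TangentSpace 𝓘(ℝ, E) x →L[ℝ]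
        (TangentSpace 𝓘(ℝ, E) x →L[ℝ] Bundle.Trivial M ℝ x)) p.2 ((J p.1).theta p.2))
  phi : ContMDiff (𝓘(ℝ, ℝ).prod 𝓘(ℝ, E)) (𝓘(ℝ, E).prod 𝓘(ℝ, E →L[ℝ] E)) ∞
    (fun p : ℝ × M => TotalSpace.mk' (E →L[ℝ] E)
      (E := fun x : M => TangentSpace 𝓘(ℝ, E) x →L[ℝ] TangentSpace 𝓘(ℝ, E) x)
      p.2 ((J p.1).phi p.2))

/-- At every point of the manifold the tensors depend real-analytically on the parameter. -/
structure AnalyticInParameter (J : ℝ → Tensors (E := E) M) : Prop where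
  F (x : M) : AnalyticOnNhd ℝ (F := E) (fun t => (J t).F x) Set.univ
  eta (x : M) : AnalyticOnNhd ℝ (F := E →L[ℝ] ℝ) (fun t => (J t).eta x) Set.univ
  pi (x : M) : AnalyticOnNhd ℝ (F := (E →L[ℝ] ℝ) →L[ℝ] E) (fun t => (J t).pi x) Set.univ
  theta (x : M) : AnalyticOnNhd ℝ (F := E →L[ℝ] E →L[ℝ] ℝ) (fun t => (J t).theta x) Set.univ
  phi (x : M) : AnalyticOnNhd ℝ (F := E →L[ℝ] E) (fun t => (J t).phi x) Set.univ

/-- Smoothness of the five tensors. -/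
def Tensors.Smooth [IsManifold 𝓘(ℝ, E) ∞ M] (J : Tensors (E := E) M) : Prop :=
  SmoothFamily (fun _ => J)

/-- Generalized almost contact pairs: smooth `(Φ, F + η)` with `Φ + Φ* = 0`, `η(F) = 1`,
`Φ(F) = Φ(η) = 0` and `Φ ∘ Φ = -1 + F ⊙ η`, where `(F ⊙ η)(X + α) = η(X) F + α(F) η`. -/
structure IsGenAlmostContact [IsManifold 𝓘(ℝ, E) ∞ M] (J : Tensors (E := E) M) : Prop where
  smooth : J.Smooth
  skew (x : M) (e e' : TangentSpace 𝓘(ℝ, E) x × CotSpace (E := E) x) :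
    pairing (J.Phi x e) e' + pairing e (J.Phi x e') = 0
  eta_F (x : M) : J.eta x (J.F x) = 1
  Phi_F (x : M) : J.Phi x (J.F x, 0) = 0
  Phi_eta (x : M) : J.Phi x (0, J.eta x) = 0
  Phi_Phi (x : M) (e : TangentSpace 𝓘(ℝ, E) x × CotSpace (E := E) x) :
    J.Phi x (J.Phi x e) = -e + (J.eta x e.1 • J.F x, e.2 (J.F x) • J.eta x)

/-- Equivalence of pairs: `Φ' = Φ`, `η' = f η`, `F' = (1/f) F` for a smooth function `f` without
zeros.  A generalized almost contact structure is an equivalence class. -/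
def Equivalent (J J' : Tensors (E := E) M) : Prop :=
  ∃ f : M → ℝ, ContMDiff 𝓘(ℝ, E) 𝓘(ℝ, ℝ) ∞ f ∧ (∀ x, f x ≠ 0) ∧
    J'.pi = J.pi ∧ J'.theta = J.theta ∧ J'.phi = J.phi ∧
    (∀ x, J'.eta x = f x • J.eta x) ∧ (∀ x, J'.F x = (f x)⁻¹ • J.F x)

/-- The fibre at `x` of the complex bundle `L = L_F ⊕ E^{(1,0)}`, where
`E^{(1,0)} = {e - i Φ(e) | e ∈ ker η ⊕ ker F}`.  An element `a + i b` of `(TM ⊕ T*M) ⊗ ℂ` is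
given by its real part `a` and its imaginary part `b`. -/
def Tensors.MemL (J : Tensors (E := E) M) (x : M)
    (a b : TangentSpace 𝓘(ℝ, E) x × CotSpace (E := E) x) : Prop :=
  ∃ (c c' : ℝ) (e : TangentSpace 𝓘(ℝ, E) x × CotSpace (E := E) x),
    J.eta x e.1 = 0 ∧ e.2 (J.F x) = 0 ∧
      a = c • (J.F x, 0) + e ∧ b = c' • (J.F x, 0) - J.Phi x e

/-- The smooth sections `a + i b` of `L` are closed under the complex-bilinear extension
`⟦a + i b, a' + i b'⟧ = (⟦a, a'⟧ - ⟦b, b'⟧) + i (⟦a, b'⟧ + ⟦b, a'⟧)` of the Courant bracket. -/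
def Tensors.CourantClosed [IsManifold 𝓘(ℝ, E) ∞ M] (J : Tensors (E := E) M) : Prop :=
  ∀ a b a' b' : GenSection (E := E) M,
    SmoothGenSection a → SmoothGenSection b → SmoothGenSection a' → SmoothGenSection b' →
    (∀ x, J.MemL x (a x) (b x)) → (∀ x, J.MemL x (a' x) (b' x)) →
    ∀ x, J.MemL x (courant a a' x - courant b b' x) (courant a b' x + courant b a' x)

/-- `J` represents a generalized contact structure. -/
structure IsGenContact [IsManifold 𝓘(ℝ, E) ∞ M] (J : Tensors (E := E) M) : Prop where
  almost : IsGenAlmostContact J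
  closed : J.CourantClosed

/-- `J₀` and `J₁` represent members of one deformation family of generalized contact structures:
there is a family `J_t`, `t ∈ ℝ`, of generalized contact structures, smooth on `ℝ × M` and
real-analytic in `t`, whose members at `t = 0` and `t = 1` are those of `J₀` and `J₁`. -/
def SameDeformationFamily [IsManifold 𝓘(ℝ, E) ∞ M] (J₀ J₁ : Tensors (E := E) M) : Prop :=
  ∃ J : ℝ → Tensors (E := E) M, SmoothFamily J ∧ AnalyticInParameter J ∧
    (∀ t, IsGenContact (J t)) ∧ Equivalent (J 0) J₀ ∧ Equivalent (J 1) J₁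

/-- `η` is a contact form: it is smooth and nowhere zero, and `dη` is nondegenerate on `ker η`
(in dimension `2n + 1`: `η ∧ (dη)^n` is nowhere zero). -/
structure IsContactForm [IsManifold 𝓘(ℝ, E) ∞ M] (η : OneForm (E := E) M) : Prop where
  smooth : SmoothOneForm η
  ne_zero (x : M) : η x ≠ 0
  nondegenerate (x : M) (X : TangentSpace 𝓘(ℝ, E) x) :
    η x X = 0 → (∀ Y, η x Y = 0 → dForm η x X Y = 0) → X = 0

/-- `J` is the generalized almost contact structure associated with the contact form `η`:
`θ = dη`, `F` is the Reeb field (`η(F) = 1`, `ι_F dη = 0`), `φ = 0`, and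
`π(♭X, ♭Y) = θ(X, Y)`, where `♭X = ι_X θ - η(X) η`. -/
structure IsAssociatedToContactForm (η : OneForm (E := E) M) (J : Tensors (E := E) M) :
    Prop where
  eta_eq : J.eta = η
  theta_eq : J.theta = dForm η
  phi_eq : J.phi = 0
  eta_F (x : M) : η x (J.F x) = 1
  reeb (x : M) : dForm η x (J.F x) = 0
  pi_flat (x : M) (X Y : TangentSpace 𝓘(ℝ, E) x) :
    (J.theta x Y - η x Y • η x) (J.pi x (J.theta x X - η x X • η x)) = J.theta x X Y

end Tensors

/-! ## The group `G` and its compact quotients -/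

/-- The simply connected five-dimensional nilpotent Lie group whose Lie algebra has the structure
equations `[e₁, e₂] = e₃`, `[e₁, e₃] = -e₅`, `[e₂, e₄] = e₅`, in global coordinates
`(x₁, …, x₅)` (indexed by `0, …, 4`).  The left-invariant coframe is `dx₁`, `dx₂`,
`dx₃ - x₁ dx₂`, `dx₄`, `dx₅ + x₁ dx₃ - (x₁² / 2) dx₂ - x₂ dx₄`, with dual frame `∂₁`,
`∂₂ + x₁ ∂₃ - (x₁² / 2) ∂₅`, `∂₃ - x₁ ∂₅`, `∂₄ + x₂ ∂₅`, `∂₅`.  Forgetting `x₅` is the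
projection onto the four-dimensional group covering the Kodaira manifold. -/
def G : Type := Fin 5 → ℝ

namespace G

instance : TopologicalSpace G := Pi.topologicalSpace
instance : T2Space G := inferInstanceAs (T2Space (Fin 5 → ℝ))
instance : LocallyCompactSpace G := inferInstanceAs (LocallyCompactSpace (Fin 5 → ℝ))
/-- The global chart of `G`. -/
instance : ChartedSpace (Fin 5 → ℝ) G := chartedSpaceSelf (Fin 5 → ℝ)
instance : IsManifold 𝓘(ℝ, Fin 5 → ℝ) ω G :=
  inferInstanceAs (IsManifold 𝓘(ℝ, Fin 5 → ℝ) ω (Fin 5 → ℝ))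

/-- The product in coordinates. -/
def mulFun (a x : Fin 5 → ℝ) : Fin 5 → ℝ :=
  ![a 0 + x 0, a 1 + x 1, a 2 + x 2 + a 0 * x 1, a 3 + x 3,
    a 4 + x 4 - a 0 * x 2 - a 0 ^ 2 / 2 * x 1 + a 1 * x 3]

/-- The inverse in coordinates. -/
def invFun (a : Fin 5 → ℝ) : Fin 5 → ℝ :=
  ![-a 0, -a 1, -a 2 + a 0 * a 1, -a 3,
    -a 4 - a 0 * a 2 + a 0 ^ 2 / 2 * a 1 + a 1 * a 3]

instance : Mul G := ⟨mulFun⟩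
instance : One G := ⟨(0 : Fin 5 → ℝ)⟩
instance : Inv G := ⟨invFun⟩

theorem mul_def (a b : G) : a * b = mulFun a b := rfl
theorem one_def : (1 : G) = (0 : Fin 5 → ℝ) := rfl
theorem inv_def (a : G) : a⁻¹ = invFun a := rfl

theorem mulFun_assoc (a b c : Fin 5 → ℝ) :
    mulFun (mulFun a b) c = mulFun a (mulFun b c) := by
  funext i
  fin_cases i <;> simp [mulFun] <;> ring

theorem zero_mulFun (a : Fin 5 → ℝ) : mulFun 0 a = a := by
  funext i
  fin_cases i <;> simp [mulFun]

theorem invFun_mulFun (a : Fin 5 → ℝ) : mulFun (invFun a) a = 0 := by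
  funext i
  fin_cases i <;> simp [mulFun, invFun]
  ring

instance : Group G := Group.ofLeftAxioms mulFun_assoc zero_mulFun invFun_mulFun

theorem contDiff_mulFun : ContDiff ℝ ω (fun p : (Fin 5 → ℝ) × (Fin 5 → ℝ) => mulFun p.1 p.2) := by
  rw [contDiff_pi]
  intro i
  fin_cases i <;> simp only [mulFun] <;> simp <;> fun_prop

theorem contDiff_invFun : ContDiff ℝ ω invFun := by
  rw [contDiff_pi]
  intro i
  fin_cases i <;> simp only [invFun] <;> simp <;> fun_prop

instance : IsTopologicalGroup G where
  continuous_mul := contDiff_mulFun.continuous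
  continuous_inv := contDiff_invFun.continuous

theorem contDiff_mul_left (a : Fin 5 → ℝ) : ContDiff ℝ ω (mulFun a) :=
  contDiff_mulFun.comp (contDiff_const.prodMk contDiff_id)

end G

variable (Γ : Subgroup G)

instance [DiscreteTopology Γ] : ProperlyDiscontinuousSMul Γ G :=
  Γ.properlyDiscontinuousSMul_of_tendsto_cofinite
    (Γ.tendsto_coe_cofinite_of_discrete (isDiscrete_iff_discreteTopology.mpr inferInstance))

/-- The manifold `M = Γ \ G` of cosets `Γ g`, i.e. of orbits of `Γ` acting on `G` by left
translations.  For discrete `Γ` its charts are the local inverses of the covering `G → M`. -/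
abbrev Nil := MulAction.orbitRel.Quotient Γ G

/-- The covering `G → Γ \ G`. -/
def proj (g : G) : Nil Γ := Quotient.mk _ g

theorem proj_eq_iff {g h : G} : proj Γ g = proj Γ h ↔ ∃ γ : Γ, (γ : G) * h = g := by
  unfold proj
  rw [Quotient.eq]
  exact Iff.rfl

section Discrete

variable [DiscreteTopology Γ]

theorem isLocalHomeomorph_proj : IsLocalHomeomorph (proj Γ) :=
  isQuotientCoveringMap_quotientMk_of_properlyDiscontinuousSMul.isCoveringMap.isLocalHomeomorph

/-- A continuous map which covers the projection is locally a left translation. -/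
theorem eventually_translation {u : G → G} {y : G} (hu : ContinuousAt u y)
    (h : ∀ᶠ z in 𝓝 y, proj Γ (u z) = proj Γ z) :
    ∃ γ : Γ, ∀ᶠ z in 𝓝 y, u z = (γ : G) * z := by
  obtain ⟨γ, hγ⟩ := (proj_eq_iff Γ).1 h.self_of_nhds
  refine ⟨γ, ?_⟩
  obtain ⟨e, he, hpe⟩ := isLocalHomeomorph_proj Γ (u y)
  have h1 : ∀ᶠ z in 𝓝 y, u z ∈ e.source :=
    hu.eventually (e.open_source.mem_nhds he)
  have hc : ContinuousAt (fun z : G => (γ : G) * z) y := by fun_prop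
  have h2 : ∀ᶠ z in 𝓝 y, (γ : G) * z ∈ e.source :=
    hc.eventually (e.open_source.mem_nhds (by simpa only [hγ] using he))
  filter_upwards [h, h1, h2] with z hz hz1 hz2
  refine e.injOn hz1 hz2 ?_
  rw [← hpe, hz]
  exact ((proj_eq_iff Γ).2 ⟨γ, rfl⟩).symm

/-- The transition maps of `Γ \ G` are locally left translations, so `Γ \ G` is a manifold. -/
instance : IsManifold 𝓘(ℝ, Fin 5 → ℝ) ω (Nil Γ) := by
  apply isManifold_of_contDiffOn
  rintro e e' ⟨q, rfl⟩ ⟨q', rfl⟩ y hy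
  set hq := isLocalHomeomorph_proj Γ
  set g : G := Quotient.mk_surjective.hasRightInverse.choose q
  set g' : G := Quotient.mk_surjective.hasRightInverse.choose q'
  let L : OpenPartialHomeomorph (Nil Γ) G := hq.localInverseAt g
  let L' : OpenPartialHomeomorph (Nil Γ) G := hq.localInverseAt g'
  let f : OpenPartialHomeomorph G G := L.symm ≫ₕ L'
  have hyf : y ∈ f.source := by
    have h := hy.1
    exact ⟨h.1.2, h.2.1⟩
  have hcov : ∀ᶠ z in 𝓝 (y : G), proj Γ (f z) = proj Γ z := by
    filter_upwards [f.open_source.mem_nhds hyf] with z hz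
    have h1 : proj Γ z ∈ L'.source := by
      have := hz.2
      simpa [L] using this
    have h2 : f z = L' (proj Γ z) := by simp [f, L]
    rw [h2]
    exact hq.apply_localInverseAt_of_mem h1
  obtain ⟨γ, hγ⟩ := eventually_translation Γ (f.continuousAt hyf) hcov
  refine ContDiffAt.contDiffWithinAt ?_
  refine (G.contDiff_mul_left (γ : G)).contDiffAt.congr_of_eventuallyEq ?_
  filter_upwards [hγ] with z hz
  exact hz

theorem contMDiff_proj : ContMDiff 𝓘(ℝ, Fin 5 → ℝ) 𝓘(ℝ, Fin 5 → ℝ) ω (proj Γ) := by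
  intro g
  have hq := isLocalHomeomorph_proj Γ
  rw [contMDiffAt_iff]
  refine ⟨hq.continuous.continuousAt, ?_⟩
  let L : OpenPartialHomeomorph (Nil Γ) G :=
    hq.localInverseAt (Quotient.mk_surjective.hasRightInverse.choose (proj Γ g))
  have hgL : proj Γ g ∈ L.source := (mem_chart_source (Fin 5 → ℝ) (proj Γ g)).1
  have hcov : ∀ᶠ z in 𝓝 g, proj Γ (L (proj Γ z)) = proj Γ z := by
    filter_upwards [hq.continuous.continuousAt.eventually (L.open_source.mem_nhds hgL)] with z hz
    exact hq.apply_localInverseAt_of_mem hz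
  have hcont : ContinuousAt (fun z => L (proj Γ z)) g :=
    (L.continuousAt hgL).comp hq.continuous.continuousAt
  obtain ⟨γ, hγ⟩ := eventually_translation Γ hcont hcov
  refine ContDiffAt.contDiffWithinAt ?_
  refine (G.contDiff_mul_left (γ : G)).contDiffAt.congr_of_eventuallyEq ?_
  filter_upwards [hγ] with z hz
  exact hz

/-- The isomorphism from the Lie algebra `T_1 G = ℝ⁵` to `T_x M` which sends `v` to the value at
`x` of the vector field on `M` induced by the left-invariant vector field `v` on `G`.  It does not
depend on the chosen representative of the coset `x`, by `triv_proj`. -/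
def triv (x : Nil Γ) : (Fin 5 → ℝ) →L[ℝ] TangentSpace 𝓘(ℝ, Fin 5 → ℝ) x :=
  let A : (Fin 5 → ℝ) →L[ℝ] (Fin 5 → ℝ) :=
    mfderiv 𝓘(ℝ, Fin 5 → ℝ) 𝓘(ℝ, Fin 5 → ℝ) (fun h : G => proj Γ (x.out * h)) 1
  A

/-- The vector field `e_{i+1}` on `M` (so `i = 0, …, 4` gives `e₁, …, e₅`). -/
def frame (i : Fin 5) : VField (E := Fin 5 → ℝ) (Nil Γ) :=
  fun x => triv Γ x (Pi.single i 1)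

/-- The 1-form `e^{i+1}` on `M`, dual to the frame. -/
def coframe (i : Fin 5) : OneForm (E := Fin 5 → ℝ) (Nil Γ) :=
  fun x => (ContinuousLinearMap.proj (R := ℝ) (φ := fun _ : Fin 5 => ℝ) i).comp (triv Γ x).inverse

theorem mdifferentiableAt_mul_left (a g : G) : MDifferentiableAt 𝓘(ℝ, Fin 5 → ℝ)
    𝓘(ℝ, Fin 5 → ℝ) (fun h : G => a * h) g := by
  have h : ContDiffAt ℝ ω (G.mulFun a) g := (G.contDiff_mul_left a).contDiffAt
  exact (h.differentiableAt (by simp)).mdifferentiableAt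

theorem triv_proj (g : G) (v : Fin 5 → ℝ) :
    triv Γ (proj Γ g) v =
      mfderiv 𝓘(ℝ, Fin 5 → ℝ) 𝓘(ℝ, Fin 5 → ℝ) (proj Γ) g
        (mulInvariantVectorField (I := 𝓘(ℝ, Fin 5 → ℝ)) (G := G) v g) := by
  have hout : proj Γ (proj Γ g).out = proj Γ g := Quotient.out_eq _
  obtain ⟨γ, hγ⟩ := (proj_eq_iff Γ).1 hout
  have hfun : (fun h : G => proj Γ ((proj Γ g).out * h)) = fun h : G => proj Γ (g * h) := by
    funext h
    rw [← hγ, mul_assoc]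
    exact (proj_eq_iff Γ).2 ⟨γ, rfl⟩
  have hp : MDifferentiableAt 𝓘(ℝ, Fin 5 → ℝ) 𝓘(ℝ, Fin 5 → ℝ) (proj Γ) (g * 1) :=
    (contMDiff_proj Γ).contMDiffAt.mdifferentiableAt (by simp)
  have hc := mfderiv_comp (I := 𝓘(ℝ, Fin 5 → ℝ)) (I' := 𝓘(ℝ, Fin 5 → ℝ))
    (I'' := 𝓘(ℝ, Fin 5 → ℝ)) (1 : G) hp (mdifferentiableAt_mul_left g 1)
  let A (u : G → Nil Γ) : (Fin 5 → ℝ) →L[ℝ] (Fin 5 → ℝ) :=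
    mfderiv 𝓘(ℝ, Fin 5 → ℝ) 𝓘(ℝ, Fin 5 → ℝ) u 1
  let B (k : G) : (Fin 5 → ℝ) →L[ℝ] (Fin 5 → ℝ) :=
    mfderiv 𝓘(ℝ, Fin 5 → ℝ) 𝓘(ℝ, Fin 5 → ℝ) (proj Γ) k
  let C : (Fin 5 → ℝ) →L[ℝ] (Fin 5 → ℝ) :=
    mfderiv 𝓘(ℝ, Fin 5 → ℝ) 𝓘(ℝ, Fin 5 → ℝ) (fun h : G => g * h) 1
  have h1 : A (fun h : G => proj Γ (g * h)) = (B (g * 1)).comp C := hc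
  have h2 : A (fun h : G => proj Γ ((proj Γ g).out * h)) v = B g (C v) := by
    rw [hfun, h1, mul_one]
    rfl
  exact h2

theorem triv_invertible (x : Nil Γ) : (triv Γ x).IsInvertible := by
  let φ : Nil Γ → (Fin 5 → ℝ) := extChartAt 𝓘(ℝ, Fin 5 → ℝ) x
  let p : G → Nil Γ := fun h => proj Γ (x.out * h)
  have hq := isLocalHomeomorph_proj Γ
  have hx : p 1 = x := by
    change proj Γ (x.out * 1) = x
    rw [mul_one]
    exact Quotient.out_eq _
  let A : (Fin 5 → ℝ) →L[ℝ] (Fin 5 → ℝ) :=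
    mfderiv 𝓘(ℝ, Fin 5 → ℝ) 𝓘(ℝ, Fin 5 → ℝ) φ (p 1)
  let L : OpenPartialHomeomorph (Nil Γ) G :=
    hq.localInverseAt (Quotient.mk_surjective.hasRightInverse.choose x)
  have hL : p 1 ∈ L.source := by
    rw [hx]
    exact (mem_chart_source (Fin 5 → ℝ) x).1
  have hm : Continuous (fun h : G => x.out * h) := by fun_prop
  -- The map `φ ∘ p` is a left translation near `1`.
  obtain ⟨γ, hγ⟩ : ∃ γ : Γ, ∀ᶠ z in 𝓝 (x.out * 1), L (proj Γ z) = (γ : G) * z := by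
    apply eventually_translation Γ
    · exact ContinuousAt.comp (f := proj Γ) (L.continuousAt hL) hq.continuous.continuousAt
    · filter_upwards [hq.continuous.continuousAt.eventually (L.open_source.mem_nhds hL)] with z hz
      exact hq.apply_localInverseAt_of_mem hz
  let a : G := (γ : G) * x.out
  have hloc : (fun h : G => φ (p h)) =ᶠ[𝓝 (1 : G)] G.mulFun a := by
    filter_upwards [hm.continuousAt.eventually hγ] with h hh
    have h1 : L (proj Γ (x.out * h)) = a * h := by rw [hh, mul_assoc]
    exact h1
  have hd (b c : Fin 5 → ℝ) : DifferentiableAt ℝ (G.mulFun b) c :=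
    (G.contDiff_mul_left b).contDiffAt.differentiableAt (by simp)
  let T := fderiv ℝ (G.mulFun a) 0
  let T' := fderiv ℝ (G.mulFun (G.invFun a)) (G.mulFun a 0)
  have hTT : T'.comp T = ContinuousLinearMap.id ℝ _ := by
    have h1 : fderiv ℝ (G.mulFun (G.invFun a) ∘ G.mulFun a) 0 = T'.comp T :=
      fderiv_comp (0 : Fin 5 → ℝ) (hd _ _) (hd _ _)
    rw [← h1]
    have : G.mulFun (G.invFun a) ∘ G.mulFun a = id := by
      funext z
      simp only [Function.comp_apply, id]
      exact inv_mul_cancel_left a (z : G)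
    rw [this, fderiv_id]
  have hφ : MDifferentiableAt 𝓘(ℝ, Fin 5 → ℝ) 𝓘(ℝ, Fin 5 → ℝ) φ (p 1) := by
    rw [hx]
    exact mdifferentiableAt_extChartAt (mem_chart_source _ x)
  have hpd : MDifferentiableAt 𝓘(ℝ, Fin 5 → ℝ) 𝓘(ℝ, Fin 5 → ℝ) p 1 :=
    MDifferentiableAt.comp (1 : G)
      ((contMDiff_proj Γ).contMDiffAt.mdifferentiableAt (by simp))
      (mdifferentiableAt_mul_left x.out 1)
  let S : (Fin 5 → ℝ) →L[ℝ] (Fin 5 → ℝ) := triv Γ x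
  have hAS : A.comp S = T := by
    have h1 := mfderiv_comp (1 : G) hφ hpd
    have h2 : mfderiv 𝓘(ℝ, Fin 5 → ℝ) 𝓘(ℝ, Fin 5 → ℝ) (φ ∘ p) 1
        = mfderiv 𝓘(ℝ, Fin 5 → ℝ) 𝓘(ℝ, Fin 5 → ℝ) (G.mulFun a) (0 : Fin 5 → ℝ) :=
      Filter.EventuallyEq.mfderiv_eq hloc
    rw [mfderiv_eq_fderiv] at h2
    exact h1.symm.trans h2
  have hleft : (T'.comp A).comp S = ContinuousLinearMap.id ℝ _ := by
    rw [ContinuousLinearMap.comp_assoc, hAS, hTT]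
  have hright : S.comp (T'.comp A) = ContinuousLinearMap.id ℝ _ := by
    apply ContinuousLinearMap.coe_injective
    have h1 : ((T'.comp A : (Fin 5 → ℝ) →L[ℝ] (Fin 5 → ℝ)) : (Fin 5 → ℝ) →ₗ[ℝ] (Fin 5 → ℝ))
        * (S : (Fin 5 → ℝ) →ₗ[ℝ] (Fin 5 → ℝ)) = 1 :=
      congrArg (fun B : (Fin 5 → ℝ) →L[ℝ] (Fin 5 → ℝ) =>
        (B : (Fin 5 → ℝ) →ₗ[ℝ] (Fin 5 → ℝ))) hleft
    exact mul_eq_one_comm.1 h1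
  exact ⟨ContinuousLinearEquiv.equivOfInverse S (T'.comp A)
    (fun v => DFunLike.congr_fun hleft v) (fun v => DFunLike.congr_fun hright v), rfl⟩

theorem coframe_frame (i j : Fin 5) (x : Nil Γ) :
    coframe Γ i x (frame Γ j x) = if i = j then 1 else 0 := by
  obtain ⟨e, he⟩ := triv_invertible Γ x
  simp only [coframe, frame, ContinuousLinearMap.comp_apply, ← he,
    ContinuousLinearMap.inverse_equiv, ContinuousLinearEquiv.coe_coe,
    ContinuousLinearEquiv.symm_apply_apply, ContinuousLinearMap.proj_apply, Pi.single_apply]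

/-- The tensors of the generalized contact structure `𝒥₀` induced by the complex structure `J`:
`F = e₅`, `η = e⁵`, `π = 0`, `θ = 0`, `φ = e₂ ⊗ e¹ - e₁ ⊗ e² + e₄ ⊗ e³ - e₃ ⊗ e⁴`. -/
def J₀ : Tensors (E := Fin 5 → ℝ) (Nil Γ) where
  F := frame Γ 4
  eta := coframe Γ 4
  pi := 0
  theta := 0
  phi x := (coframe Γ 0 x).smulRight (frame Γ 1 x) - (coframe Γ 1 x).smulRight (frame Γ 0 x)
    + (coframe Γ 2 x).smulRight (frame Γ 3 x) - (coframe Γ 3 x).smulRight (frame Γ 2 x)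

/-- The tensors of the structure `𝒥₁` of the contact form `e⁵`: `F = e₅`, `η = e⁵`, `φ = 0`,
`π = e₁ ∧ e₃ - e₂ ∧ e₄`, `θ = e¹ ∧ e³ - e² ∧ e⁴`. -/
def J₁ : Tensors (E := Fin 5 → ℝ) (Nil Γ) where
  F := frame Γ 4
  eta := coframe Γ 4
  pi x := sharpWedge (frame Γ 0 x) (frame Γ 2 x) - sharpWedge (frame Γ 1 x) (frame Γ 3 x)
  theta x := flatWedge (coframe Γ 0 x) (coframe Γ 2 x) - flatWedge (coframe Γ 1 x) (coframe Γ 3 x)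
  phi := 0

end Discrete

end GenContact

end

open Bundle Manifold
open scoped ContDiff Topology

noncomputable section

namespace GenContact

/-! The two structures share `F = e₅` and `η = e⁵`, and the endomorphisms `Φ₀`, `Φ₁` attached to
`J₀`, `J₁` anticommute and both square to `-1` on `ker η ⊕ ker F`: `θ = e¹∧e³ - e²∧e⁴` is the real
part of `(e¹ + i e²)∧(e³ + i e⁴)`, a form of type `(2,0)` for `J`. Hence `c Φ₀ + s Φ₁` is again an
almost structure whenever `c² + s² = 1`, and a quarter of this circle joins `J₀` to `J₁`.

Integrability is a matter of closed forms. With `θ' = e¹∧e⁴ + e²∧e³`, for `s ≠ 0` the bundle `L` is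
the graph of `X ↦ ι_X σ`, where `σ = -(iθ + cθ')/s`. Since `de³ = -e¹∧e²` and `e¹, e², e⁴` are
closed, `σ` is closed, so its graph is closed under the Courant bracket. At `s = 0` closure
expresses the integrability of `J` transverse to `F`. Membership in `L` does not constrain the
`e₅`-component of the vector and forces the covector to vanish on `e₅`; so the central brackets play
no part in integrability. They matter only for `de⁵ = θ`, which makes `e⁵` a contact form.

The formal argument treats all `(c, s)` at once in the invariant frame. There the Courant bracket is
a sum of three parts (`vc_courant`, `fv_courant`): derivatives of the components, the bracket of
invariant sections, and half the difference of two pairings of one section with a derivative of the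
other. The fibre of `L` is given by linear equations with constant coefficients (`ModelL`), so
derivatives of components stay in it (`modelL_invDeriv`); it is isotropic, which removes the pairing
terms; and the invariant bracket preserves it (`ModelL.bracket`). The component formulas rest on the
Maurer-Cartan equation `fderiv_leftDiff_sub`, through `dForm_triv` and `vcomp_mlieBracket`. -/

section

/-! ## Invariant fields in coordinates -/

/-- The differential at the identity of the left translation by `y`, in coordinates. -/
def leftDiff (y : Fin 5 → ℝ) : (Fin 5 → ℝ) →L[ℝ] (Fin 5 → ℝ) :=
  LinearMap.toContinuousLinearMap
    { toFun := fun v => ![v 0, v 1, v 2 + y 0 * v 1, v 3,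
        v 4 - y 0 * v 2 - y 0 ^ 2 / 2 * v 1 + y 1 * v 3]
      map_add' := fun u v => by ext i; fin_cases i <;> simp; all_goals ring
      map_smul' := fun r v => by ext i; fin_cases i <;> simp; all_goals ring }

/-- The inverse of `leftDiff y`. -/
def leftDiffInv (y : Fin 5 → ℝ) : (Fin 5 → ℝ) →L[ℝ] (Fin 5 → ℝ) :=
  LinearMap.toContinuousLinearMap
    { toFun := fun v => ![v 0, v 1, v 2 - y 0 * v 1, v 3,
        v 4 + y 0 * v 2 - y 0 ^ 2 / 2 * v 1 - y 1 * v 3]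
      map_add' := fun u v => by ext i; fin_cases i <;> simp; all_goals ring
      map_smul' := fun r v => by ext i; fin_cases i <;> simp; all_goals ring }

theorem leftDiff_apply (y v : Fin 5 → ℝ) :
    leftDiff y v = ![v 0, v 1, v 2 + y 0 * v 1, v 3,
      v 4 - y 0 * v 2 - y 0 ^ 2 / 2 * v 1 + y 1 * v 3] := rfl

theorem leftDiffInv_apply (y v : Fin 5 → ℝ) :
    leftDiffInv y v = ![v 0, v 1, v 2 - y 0 * v 1, v 3,
      v 4 + y 0 * v 2 - y 0 ^ 2 / 2 * v 1 - y 1 * v 3] := rfl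

theorem leftDiffInv_leftDiff (y v : Fin 5 → ℝ) : leftDiffInv y (leftDiff y v) = v := by
  ext i; fin_cases i <;> simp [leftDiff_apply, leftDiffInv_apply] <;> ring

theorem leftDiff_leftDiffInv (y v : Fin 5 → ℝ) : leftDiff y (leftDiffInv y v) = v := by
  ext i; fin_cases i <;> simp [leftDiff_apply, leftDiffInv_apply] <;> ring

theorem contDiff_leftDiff : ContDiff ℝ ∞ leftDiff := by
  rw [contDiff_clm_apply_iff]
  intro v
  rw [contDiff_pi]
  intro i
  fin_cases i <;> simp [leftDiff_apply] <;> fun_prop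

theorem contDiff_leftDiffInv : ContDiff ℝ ∞ leftDiffInv := by
  rw [contDiff_clm_apply_iff]
  intro v
  rw [contDiff_pi]
  intro i
  fin_cases i <;> simp [leftDiffInv_apply] <;> fun_prop

/-- The bracket of the Lie algebra of `G`, in the basis `e₁, …, e₅`. -/
def lieBr (u v : Fin 5 → ℝ) : Fin 5 → ℝ :=
  ![0, 0, u 0 * v 1 - u 1 * v 0, 0,
    -(u 0 * v 2 - u 2 * v 0) + (u 1 * v 3 - u 3 * v 1)]

theorem fderiv_leftDiff_apply (y u v : Fin 5 → ℝ) :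
    fderiv ℝ leftDiff y u v = ![0, 0, u 0 * v 1, 0,
      -(u 0 * v 2) - y 0 * u 0 * v 1 + u 1 * v 3] := by
  have hd : HasFDerivAt leftDiff (fderiv ℝ leftDiff y) y :=
    (contDiff_leftDiff.differentiable (by simp) y).hasFDerivAt
  have h1 : HasFDerivAt (fun z => leftDiff z v)
      ((ContinuousLinearMap.apply ℝ (Fin 5 → ℝ) v).comp (fderiv ℝ leftDiff y)) y :=
    (ContinuousLinearMap.apply ℝ (Fin 5 → ℝ) v).hasFDerivAt.comp y hd
  have hp (i : Fin 5) : HasFDerivAt (fun z : Fin 5 → ℝ => z i)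
      (ContinuousLinearMap.proj (R := ℝ) (φ := fun _ : Fin 5 => ℝ) i) y :=
    (ContinuousLinearMap.proj (R := ℝ) (φ := fun _ : Fin 5 => ℝ) i).hasFDerivAt
  rw [hasFDerivAt_pi'] at h1
  ext i
  have h2 := h1 i
  have key {f : (Fin 5 → ℝ) → ℝ} {f' : (Fin 5 → ℝ) →L[ℝ] ℝ} (hf : HasFDerivAt f f' y)
      (he : (fun z => leftDiff z v i) = f) : fderiv ℝ leftDiff y u v i = f' u := by
    rw [he] at h2
    exact DFunLike.congr_fun (h2.unique hf) u
  fin_cases i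
  · rw [key (hasFDerivAt_const (v 0) y) rfl]; rfl
  · rw [key (hasFDerivAt_const (v 1) y) rfl]; rfl
  · rw [key (((hp 0).mul_const (v 1)).const_add (v 2)) rfl]
    simp; ring
  · rw [key (hasFDerivAt_const (v 3) y) rfl]; rfl
  · rw [key (f := fun z => v 4 - z 0 * v 2 - z 0 ^ 2 / 2 * v 1 + z 1 * v 3)
      (f' := (0 - v 2 • (ContinuousLinearMap.proj (R := ℝ) (φ := fun _ : Fin 5 => ℝ) 0)
        - (y 0 * v 1) • (ContinuousLinearMap.proj (R := ℝ) (φ := fun _ : Fin 5 => ℝ) 0))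
        + v 3 • (ContinuousLinearMap.proj (R := ℝ) (φ := fun _ : Fin 5 => ℝ) 1))
      ?_ rfl]
    · simp; ring
    · refine HasFDerivAt.add (HasFDerivAt.sub (HasFDerivAt.sub (hasFDerivAt_const _ _)
        ((hp 0).mul_const _)) ?_) ((hp 1).mul_const _)
      -- The quadratic term is regrouped as `z 0 ^ 2 * (1 / 2 * v 1)`, so that the power rule
      -- applies directly.
      have h3 := (((hp 0).pow 2).mul_const (1 / 2 * v 1))
      convert! h3 using 1
      · ext z; simp; ring
      · ext w; simp; ring

/-- The Maurer-Cartan equation. -/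
theorem fderiv_leftDiff_sub (y u v : Fin 5 → ℝ) :
    fderiv ℝ leftDiff y (leftDiff y u) v - fderiv ℝ leftDiff y (leftDiff y v) u
      = leftDiff y (lieBr u v) := by
  rw [fderiv_leftDiff_apply, fderiv_leftDiff_apply]
  ext i; fin_cases i <;> simp [leftDiff_apply, lieBr] <;> ring

/-- In these coordinates a left translation is affine, with linear part `leftDiff y`. This
identifies the invariant vector fields with the columns of `leftDiff`. -/
theorem fderiv_mulFun (y v : Fin 5 → ℝ) : fderiv ℝ (G.mulFun y) 0 v = leftDiff y v := by
  have h : G.mulFun y = fun z => y + leftDiff y z := by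
    funext z; ext i; fin_cases i <;> simp [leftDiff_apply, G.mulFun] <;> ring
  rw [h, fderiv_const_add, ContinuousLinearMap.fderiv]

/-! ### The covering and its charts -/

variable (Γ : Subgroup G)

/-- The covering `G → Γ \ G` as a map on the coordinate space. -/
def cover (y : Fin 5 → ℝ) : Nil Γ := proj Γ y

variable [DiscreteTopology Γ]

theorem contMDiff_cover : ContMDiff 𝓘(ℝ, Fin 5 → ℝ) 𝓘(ℝ, Fin 5 → ℝ) ω (cover Γ) :=
  contMDiff_proj Γ

theorem mdifferentiableAt_cover (y : Fin 5 → ℝ) :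
    MDifferentiableAt 𝓘(ℝ, Fin 5 → ℝ) 𝓘(ℝ, Fin 5 → ℝ) (cover Γ) y :=
  (contMDiff_cover Γ).contMDiffAt.mdifferentiableAt (by simp)

/-- The charts are local inverses of the covering, whose inverse maps are the covering itself as a
function on all of `ℝ⁵`. The chart expressions below therefore hold at every `y`, not only in the
chart target. -/
theorem extChartAt_symm (x : Nil Γ) : ⇑(extChartAt 𝓘(ℝ, Fin 5 → ℝ) x).symm = cover Γ := by
  have := (isLocalHomeomorph_proj Γ).localInverseAt_symm
    (Quotient.mk_surjective.hasRightInverse.choose x)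
  exact this

theorem cover_extChartAt {x z : Nil Γ} (hz : z ∈ (chartAt (Fin 5 → ℝ) x).source) :
    cover Γ (extChartAt 𝓘(ℝ, Fin 5 → ℝ) x z) = z := by
  rw [← extChartAt_symm Γ x]
  exact (extChartAt 𝓘(ℝ, Fin 5 → ℝ) x).left_inv (by simpa using hz)

theorem triv_cover (y v : Fin 5 → ℝ) :
    triv Γ (cover Γ y) v
      = mfderiv 𝓘(ℝ, Fin 5 → ℝ) 𝓘(ℝ, Fin 5 → ℝ) (cover Γ) y (leftDiff y v) := by
  have h := triv_proj Γ y v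
  have h2 : mulInvariantVectorField (I := 𝓘(ℝ, Fin 5 → ℝ)) (G := G) v y = leftDiff y v := by
    rw [← fderiv_mulFun, ← mfderiv_eq_fderiv]
    rfl
  rw [h2] at h
  exact h

/-- The frame at a point of `Γ \ G`, as an isomorphism. -/
def trivEquiv (x : Nil Γ) : (Fin 5 → ℝ) ≃L[ℝ] TangentSpace 𝓘(ℝ, Fin 5 → ℝ) x :=
  (triv_invertible Γ x).choose

theorem coe_trivEquiv (x : Nil Γ) :
    (trivEquiv Γ x : (Fin 5 → ℝ) →L[ℝ] TangentSpace 𝓘(ℝ, Fin 5 → ℝ) x) = triv Γ x :=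
  (triv_invertible Γ x).choose_spec

theorem trivEquiv_apply (x : Nil Γ) (v : Fin 5 → ℝ) : trivEquiv Γ x v = triv Γ x v :=
  DFunLike.congr_fun (coe_trivEquiv Γ x) v

theorem coframe_apply (i : Fin 5) (x : Nil Γ) (X : TangentSpace 𝓘(ℝ, Fin 5 → ℝ) x) :
    coframe Γ i x X = (trivEquiv Γ x).symm X i := by
  rw [coframe, ← coe_trivEquiv, ContinuousLinearMap.inverse_equiv]
  rfl

/-- The differential of the covering, as an isomorphism. -/
def coverEquiv (y : Fin 5 → ℝ) :
    (Fin 5 → ℝ) ≃L[ℝ] TangentSpace 𝓘(ℝ, Fin 5 → ℝ) (cover Γ y) :=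
  (ContinuousLinearEquiv.equivOfInverse (leftDiff y) (leftDiffInv y) (leftDiffInv_leftDiff y)
    (leftDiff_leftDiffInv y)).symm.trans (trivEquiv Γ (cover Γ y))

theorem coe_coverEquiv (y : Fin 5 → ℝ) :
    (coverEquiv Γ y : (Fin 5 → ℝ) →L[ℝ] TangentSpace 𝓘(ℝ, Fin 5 → ℝ) (cover Γ y))
      = mfderiv 𝓘(ℝ, Fin 5 → ℝ) 𝓘(ℝ, Fin 5 → ℝ) (cover Γ) y := by
  ext1 v
  change trivEquiv Γ (cover Γ y) (leftDiffInv y v) = _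
  rw [trivEquiv_apply, triv_cover, leftDiff_leftDiffInv]
  rfl

end

section

variable (Γ : Subgroup G) [DiscreteTopology Γ]

/-! ## Exterior calculus on `Γ \ G` in the invariant frame -/

/-- The coordinates of the centre of the preferred chart at `x`. -/
def center (x : Nil Γ) : Fin 5 → ℝ := extChartAt 𝓘(ℝ, Fin 5 → ℝ) x x

theorem cover_center (x : Nil Γ) : cover Γ (center Γ x) = x :=
  cover_extChartAt Γ (mem_chart_source _ x)

theorem mfderiv_cover_center (x : Nil Γ) (v : Fin 5 → ℝ) :
    mfderiv 𝓘(ℝ, Fin 5 → ℝ) 𝓘(ℝ, Fin 5 → ℝ) (cover Γ) (center Γ x) v = v := by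
  have h := mfderivWithin_range_extChartAt_symm (I := 𝓘(ℝ, Fin 5 → ℝ)) (x := x)
  -- The tangent space in which the derivative takes values depends on the base map; generalizing
  -- the map and substituting replaces a rewrite under dependent types. The same device recurs
  -- below.
  have key (f : (Fin 5 → ℝ) → Nil Γ) (hf : f = cover Γ)
      (h : (mfderivWithin 𝓘(ℝ, Fin 5 → ℝ) 𝓘(ℝ, Fin 5 → ℝ) f (Set.range 𝓘(ℝ, Fin 5 → ℝ))
        (center Γ x) : (Fin 5 → ℝ) →L[ℝ] (Fin 5 → ℝ)) = ContinuousLinearMap.id ℝ _) :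
      mfderiv 𝓘(ℝ, Fin 5 → ℝ) 𝓘(ℝ, Fin 5 → ℝ) (cover Γ) (center Γ x) v = v := by
    subst hf
    rw [modelWithCornersSelf_coe, Set.range_id, mfderivWithin_univ] at h
    exact DFunLike.congr_fun h v
  exact key _ (extChartAt_symm Γ x) h

/-- At the centre of a chart the frame is read as `leftDiff`. -/
theorem triv_eq_leftDiff (x : Nil Γ) (v : Fin 5 → ℝ) :
    triv Γ x v = leftDiff (center Γ x) v := by
  have key (y : Fin 5 → ℝ) (hy : cover Γ y = x) :
      triv Γ x v = (mfderiv 𝓘(ℝ, Fin 5 → ℝ) 𝓘(ℝ, Fin 5 → ℝ) (cover Γ) y (leftDiff y v) :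
        Fin 5 → ℝ) := by
    subst hy
    exact triv_cover Γ y v
  exact (key _ (cover_center Γ x)).trans (mfderiv_cover_center Γ x _)

variable {Γ}

/-- The components of a vector field in the invariant frame. -/
def vcomp (X : VField (E := Fin 5 → ℝ) (Nil Γ)) (x : Nil Γ) : Fin 5 → ℝ :=
  (trivEquiv Γ x).symm (X x)

/-- The components of a 1-form in the invariant frame. -/
def fcomp (α : OneForm (E := Fin 5 → ℝ) (Nil Γ)) (x : Nil Γ) : (Fin 5 → ℝ) →L[ℝ] ℝ :=
  (α x).comp (triv Γ x)

theorem triv_vcomp (X : VField (E := Fin 5 → ℝ) (Nil Γ)) (x : Nil Γ) :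
    triv Γ x (vcomp X x) = X x := by
  rw [vcomp, ← trivEquiv_apply, ContinuousLinearEquiv.apply_symm_apply]

theorem fcomp_apply (α : OneForm (E := Fin 5 → ℝ) (Nil Γ)) (x : Nil Γ) (v : Fin 5 → ℝ) :
    fcomp α x v = α x (triv Γ x v) := rfl

theorem fcomp_vcomp (α : OneForm (E := Fin 5 → ℝ) (Nil Γ)) (X : VField (E := Fin 5 → ℝ) (Nil Γ))
    (x : Nil Γ) : fcomp α x (vcomp X x) = α x (X x) := by
  rw [fcomp_apply, triv_vcomp]

/-- The derivative of `f` along invariant vector fields. -/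
def invDeriv {F : Type*} [NormedAddCommGroup F] [NormedSpace ℝ F] (f : Nil Γ → F) (x : Nil Γ) :
    (Fin 5 → ℝ) →L[ℝ] F :=
  (fderiv ℝ (fun y => f (cover Γ y)) (center Γ x)).comp (leftDiff (center Γ x))

/-- Smoothness of a map on `Γ \ G`, tested on the covering. -/
def CoverSmooth {F : Type*} [NormedAddCommGroup F] [NormedSpace ℝ F] (f : Nil Γ → F) : Prop :=
  ContDiff ℝ ∞ (fun y => f (cover Γ y))

section

variable {F : Type*} [NormedAddCommGroup F] [NormedSpace ℝ F]

theorem CoverSmooth.differentiable {Γ : Subgroup G} {f : Nil Γ → F} (hf : CoverSmooth f) :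
    Differentiable ℝ (fun y => f (cover Γ y)) :=
  ContDiff.differentiable hf (by simp)

theorem coverSmooth_of_contMDiff {f : Nil Γ → F}
    (hf : ContMDiff 𝓘(ℝ, Fin 5 → ℝ) 𝓘(ℝ, F) ∞ f) : CoverSmooth f :=
  (hf.comp ((contMDiff_cover Γ).of_le (by simp))).contDiff

/-- Near `x` the function is its lift to the covering composed with the chart at `x`. -/
theorem CoverSmooth.contMDiff {f : Nil Γ → F} (hf : CoverSmooth f) :
    ContMDiff 𝓘(ℝ, Fin 5 → ℝ) 𝓘(ℝ, F) ∞ f := by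
  intro x
  have h : ContMDiffAt 𝓘(ℝ, Fin 5 → ℝ) 𝓘(ℝ, F) ∞
      (fun z => f (cover Γ (extChartAt 𝓘(ℝ, Fin 5 → ℝ) x z))) x :=
    (ContDiff.contMDiff hf).contMDiffAt.comp x
      (contMDiffAt_extChartAt (I := 𝓘(ℝ, Fin 5 → ℝ)) (x := x) (n := ∞))
  refine h.congr_of_eventuallyEq ?_
  filter_upwards [(chartAt (Fin 5 → ℝ) x).open_source.mem_nhds (mem_chart_source _ x)] with z hz
  rw [cover_extChartAt Γ hz]

end

theorem dFun_triv {f : Nil Γ → ℝ} (hf : CoverSmooth f) (x : Nil Γ) (v : Fin 5 → ℝ) :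
    dFun f x (triv Γ x v) = invDeriv f x v := by
  have key (y : Fin 5 → ℝ) (hy : cover Γ y = x) :
      dFun f x (triv Γ x v) = fderiv ℝ (fun y => f (cover Γ y)) y (leftDiff y v) := by
    subst hy
    rw [triv_cover, ← mfderiv_eq_fderiv]
    have h := mfderiv_comp (I' := 𝓘(ℝ, Fin 5 → ℝ)) y
      (hf.contMDiff.mdifferentiable (by simp) (cover Γ y)) (mdifferentiableAt_cover Γ y)
    exact (DFunLike.congr_fun h (leftDiff y v)).symm
  exact key _ (cover_center Γ x)

theorem chartForm_eq (α : OneForm (E := Fin 5 → ℝ) (Nil Γ)) (x : Nil Γ) (y : Fin 5 → ℝ) :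
    chartForm α x y = (fcomp α (cover Γ y)).comp (leftDiffInv y) := by
  have key (f : (Fin 5 → ℝ) → Nil Γ) (hf : f = cover Γ) :
      ((α (f y)).comp (mfderiv 𝓘(ℝ, Fin 5 → ℝ) 𝓘(ℝ, Fin 5 → ℝ) f y) :
        (Fin 5 → ℝ) →L[ℝ] ℝ) = (fcomp α (cover Γ y)).comp (leftDiffInv y) := by
    subst hf
    ext1 v
    have h := triv_cover Γ y (leftDiffInv y v)
    rw [leftDiff_leftDiffInv] at h
    exact congrArg (α (cover Γ y)) h.symm
  exact key _ (extChartAt_symm Γ x)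

/-- This is `dα(u, v) = u(α(v)) - v(α(u)) - α([u, v])` for invariant fields `u`, `v`; the last term
comes from the variation of the frame. -/
theorem dForm_triv {α : OneForm (E := Fin 5 → ℝ) (Nil Γ)} (hα : CoverSmooth (fcomp α))
    (x : Nil Γ) (u v : Fin 5 → ℝ) :
    dForm α x (triv Γ x u) (triv Γ x v)
      = invDeriv (fcomp α) x u v - invDeriv (fcomp α) x v u - fcomp α x (lieBr u v) := by
  set y₀ := center Γ x
  have hS : chartForm α x = fun y => (fcomp α (cover Γ y)).comp (leftDiffInv y) :=
    funext (chartForm_eq α x)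
  have hd : DifferentiableAt ℝ (chartForm α x) y₀ := by
    rw [hS]
    exact (hα.differentiable _).clm_comp (contDiff_leftDiffInv.differentiable (by simp) _)
  let D : (Fin 5 → ℝ) →L[ℝ] (Fin 5 → ℝ) →L[ℝ] ℝ := fderiv ℝ (chartForm α x) y₀
  -- Product rule for the components, written as the chart form composed with `leftDiff`. After
  -- antisymmetrization, the derivatives of `leftDiff` combine to the Lie bracket by Maurer-Cartan.
  have h1 (w v : Fin 5 → ℝ) : fderiv ℝ (fun y => fcomp α (cover Γ y)) y₀ w v
      = D w (leftDiff y₀ v) + chartForm α x y₀ (fderiv ℝ leftDiff y₀ w v) := by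
    have h2 : (fun y => fcomp α (cover Γ y)) = fun y => (chartForm α x y).comp (leftDiff y) := by
      funext y
      ext1 v
      rw [hS, ContinuousLinearMap.comp_apply, ContinuousLinearMap.comp_apply,
        leftDiffInv_leftDiff]
    rw [h2, (hd.hasFDerivAt.clm_comp
      (contDiff_leftDiff.differentiable (by simp) y₀).hasFDerivAt).fderiv]
    simp [D, add_comm]
  have h3 : dForm α x (triv Γ x u) (triv Γ x v)
      = D (leftDiff y₀ u) (leftDiff y₀ v) - D (leftDiff y₀ v) (leftDiff y₀ u) := by
    have hA := mfderiv_extChartAt_self (I := 𝓘(ℝ, Fin 5 → ℝ)) (x := x)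
    have key (A : (Fin 5 → ℝ) →L[ℝ] (Fin 5 → ℝ)) (hA : A = ContinuousLinearMap.id ℝ _)
        (a b : Fin 5 → ℝ) : (D - D.flip).bilinearComp A A a b = D a b - D b a := by
      subst hA; rfl
    rw [triv_eq_leftDiff, triv_eq_leftDiff]
    exact key _ hA _ _
  have h4 : fcomp α x (lieBr u v) = chartForm α x y₀ (leftDiff y₀ (lieBr u v)) := by
    rw [hS, ContinuousLinearMap.comp_apply, leftDiffInv_leftDiff, cover_center]
  rw [h3, h4, ← fderiv_leftDiff_sub, map_sub, invDeriv, ContinuousLinearMap.comp_apply,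
    ContinuousLinearMap.comp_apply, h1, h1]
  ring

/-- In the chart at `x` a field reads `leftDiff y` applied to its components. Differentiating this
product gives the derivatives of the components plus, by Maurer-Cartan, the bracket of the
components in the Lie algebra. -/
theorem vcomp_mlieBracket {X Y : VField (E := Fin 5 → ℝ) (Nil Γ)} (hX : CoverSmooth (vcomp X))
    (hY : CoverSmooth (vcomp Y)) (x : Nil Γ) :
    vcomp (VectorField.mlieBracket 𝓘(ℝ, Fin 5 → ℝ) X Y) x
      = invDeriv (vcomp Y) x (vcomp X x) - invDeriv (vcomp X) x (vcomp Y x)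
        + lieBr (vcomp X x) (vcomp Y x) := by
  set y₀ := center Γ x with hy₀
  have hpull (f : (Fin 5 → ℝ) → Nil Γ) (hf : f = cover Γ)
      (V : VField (E := Fin 5 → ℝ) (Nil Γ)) :
      VectorField.mpullbackWithin 𝓘(ℝ, Fin 5 → ℝ) 𝓘(ℝ, Fin 5 → ℝ) f V
        (Set.range 𝓘(ℝ, Fin 5 → ℝ)) = fun y => leftDiff y (vcomp V (cover Γ y)) := by
    subst hf
    funext y
    rw [VectorField.mpullbackWithin_apply, modelWithCornersSelf_coe, Set.range_id,
      mfderivWithin_univ, ← coe_coverEquiv]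
    exact DFunLike.congr_fun (ContinuousLinearMap.inverse_equiv (coverEquiv Γ y)) _
  have hder {V : VField (E := Fin 5 → ℝ) (Nil Γ)} (hV : CoverSmooth (vcomp V)) (w : Fin 5 → ℝ) :
      fderiv ℝ (fun y => leftDiff y (vcomp V (cover Γ y))) y₀ (leftDiff y₀ w)
        = leftDiff y₀ (invDeriv (vcomp V) x w)
          + fderiv ℝ leftDiff y₀ (leftDiff y₀ w) (vcomp V x) := by
    rw [((contDiff_leftDiff.differentiable (by simp) y₀).hasFDerivAt.clm_apply
      (hV.differentiable y₀).hasFDerivAt).fderiv]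
    simp [invDeriv, ← hy₀, y₀, cover_center]
  have hbr : VectorField.mlieBracket 𝓘(ℝ, Fin 5 → ℝ) X Y x
      = VectorField.lieBracket ℝ (fun y => leftDiff y (vcomp X (cover Γ y)))
          (fun y => leftDiff y (vcomp Y (cover Γ y))) y₀ := by
    -- A chart has identity differential at its own centre, because the tangent space at `x` is
    -- modelled through that chart; pulling back there changes nothing.
    have key (V : (y : Fin 5 → ℝ) → TangentSpace 𝓘(ℝ, Fin 5 → ℝ) y) :
        VectorField.mpullback 𝓘(ℝ, Fin 5 → ℝ) 𝓘(ℝ, Fin 5 → ℝ) (extChartAt 𝓘(ℝ, Fin 5 → ℝ) x) V x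
          = V y₀ := by
      have hid (A : (Fin 5 → ℝ) →L[ℝ] (Fin 5 → ℝ)) (hA : A = ContinuousLinearMap.id ℝ _)
          (w : Fin 5 → ℝ) : A.inverse w = w := by
        rw [hA, ContinuousLinearMap.inverse_id, ContinuousLinearMap.id_apply]
      exact hid _ (mfderiv_extChartAt_self (I := 𝓘(ℝ, Fin 5 → ℝ)) (x := x)) (V y₀)
    rw [VectorField.mlieBracket, VectorField.mlieBracketWithin, hpull _ (extChartAt_symm Γ x),
      hpull _ (extChartAt_symm Γ x)]
    refine (key _).trans ?_
    rw [modelWithCornersSelf_coe, Set.range_id, Set.preimage_univ, Set.inter_univ,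
      VectorField.lieBracketWithin_univ]
  have hgoal : VectorField.mlieBracket 𝓘(ℝ, Fin 5 → ℝ) X Y x
      = triv Γ x (invDeriv (vcomp Y) x (vcomp X x) - invDeriv (vcomp X) x (vcomp Y x)
        + lieBr (vcomp X x) (vcomp Y x)) := by
    rw [hbr, triv_eq_leftDiff, VectorField.lieBracket, cover_center, hder hX, hder hY, map_add,
      map_sub, ← fderiv_leftDiff_sub]
    abel
  rw [vcomp, hgoal, ← trivEquiv_apply, ContinuousLinearEquiv.symm_apply_apply]

end

/-! ## Smooth sections of tensor bundles -/

section Sections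

variable {E : Type*} [NormedAddCommGroup E] [NormedSpace ℝ E]
  {M : Type*} [TopologicalSpace M] [ChartedSpace E M]
  {F₁ : Type*} [NormedAddCommGroup F₁] [NormedSpace ℝ F₁] {V₁ : M → Type*}
  [∀ x, AddCommGroup (V₁ x)] [∀ x, Module ℝ (V₁ x)] [TopologicalSpace (TotalSpace F₁ V₁)]
  [∀ x, TopologicalSpace (V₁ x)] [FiberBundle F₁ V₁] [VectorBundle ℝ F₁ V₁]
  {F₂ : Type*} [NormedAddCommGroup F₂] [NormedSpace ℝ F₂] {V₂ : M → Type*}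
  [∀ x, AddCommGroup (V₂ x)] [∀ x, Module ℝ (V₂ x)] [TopologicalSpace (TotalSpace F₂ V₂)]
  [∀ x, TopologicalSpace (V₂ x)] [FiberBundle F₂ V₂] [VectorBundle ℝ F₂ V₂]

/-- Smoothness of a section of a vector bundle. -/
abbrev SmoothSection (E : Type*) [NormedAddCommGroup E] [NormedSpace ℝ E]
    {M : Type*} [TopologicalSpace M] [ChartedSpace E M]
    (F : Type*) [NormedAddCommGroup F] [NormedSpace ℝ F] {V : M → Type*}
    [TopologicalSpace (TotalSpace F V)] [∀ x, TopologicalSpace (V x)] [FiberBundle F V]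
    (s : (x : M) → V x) : Prop :=
  ContMDiff 𝓘(ℝ, E) (𝓘(ℝ, E).prod 𝓘(ℝ, F)) ∞ (fun x => TotalSpace.mk' F x (s x))

/-- Each parameter-dependent tensor of the family is a function of `t` times a fixed section, so
joint smoothness on `ℝ × M` reduces to this product. -/
theorem SmoothSection.smul_param {s : (x : M) → V₁ x} (hs : SmoothSection E F₁ s)
    {c : ℝ → ℝ} (hc : ContDiff ℝ ∞ c) :
    ContMDiff (𝓘(ℝ, ℝ).prod 𝓘(ℝ, E)) (𝓘(ℝ, E).prod 𝓘(ℝ, F₁)) ∞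
      (fun p : ℝ × M => TotalSpace.mk' F₁ (E := V₁) p.2 (c p.1 • s p.2)) := by
  intro p₀
  rw [contMDiffAt_totalSpace]
  refine ⟨contMDiffAt_snd, ?_⟩
  have h1 : ContMDiffAt (𝓘(ℝ, ℝ).prod 𝓘(ℝ, E)) 𝓘(ℝ, F₁) ∞
      (fun p : ℝ × M => c p.1 • (trivializationAt F₁ V₁ p₀.2 ⟨p.2, s p.2⟩).2) p₀ :=
    ContMDiffAt.smul (hc.contMDiff.contMDiffAt.comp p₀ contMDiffAt_fst)
      (((contMDiffAt_section p₀.2).1 (hs p₀.2)).comp p₀ contMDiffAt_snd)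
  refine h1.congr_of_eventuallyEq ?_
  have hb := (trivializationAt F₁ V₁ p₀.2).open_baseSet.mem_nhds
    (FiberBundle.mem_baseSet_trivializationAt' p₀.2)
  filter_upwards [continuousAt_snd.eventually hb] with p hp
  exact ((trivializationAt F₁ V₁ p₀.2).linear ℝ hp).map_smul _ _

variable [∀ x, IsTopologicalAddGroup (V₂ x)] [∀ x, ContinuousSMul ℝ (V₂ x)]

/-- The section `α ⊗ Y` of a bundle of homomorphisms is smooth. -/
theorem SmoothSection.smulRight
    {α : (x : M) → V₁ x →L[ℝ] Bundle.Trivial M ℝ x} {Y : (x : M) → V₂ x}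
    (hα : SmoothSection E (F₁ →L[ℝ] ℝ) (V := fun x => V₁ x →L[ℝ] Bundle.Trivial M ℝ x) α)
    (hY : SmoothSection E F₂ Y) :
    SmoothSection E (F₁ →L[ℝ] F₂) (V := fun x => V₁ x →L[ℝ] V₂ x)
      (fun x => (show V₁ x →L[ℝ] ℝ from α x).smulRight (Y x)) := by
  intro x₀
  have h1 := ((contMDiffAt_hom_bundle _).1 (hα x₀)).2
  have h2 := (contMDiffAt_section x₀).1 (hY x₀)
  rw [contMDiffAt_hom_bundle]
  refine ⟨contMDiffAt_id, ?_⟩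
  have hs : ContDiff ℝ ∞ (fun p : (F₁ →L[ℝ] ℝ) × F₂ => p.1.smulRight p.2) :=
    isBoundedBilinearMap_smulRight.contDiff
  have h3 := hs.contMDiff.contMDiffAt.comp x₀ (h1.prodMk_space h2)
  refine h3.congr_of_eventuallyEq ?_
  have hb := (trivializationAt F₂ V₂ x₀).open_baseSet.mem_nhds
    (FiberBundle.mem_baseSet_trivializationAt' x₀)
  filter_upwards [hb] with x hx
  ext v
  simp [ContinuousLinearMap.inCoordinates, hx]

end Sections

section Eval

variable {E : Type*} [NormedAddCommGroup E] [NormedSpace ℝ E]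
  {M : Type*} [TopologicalSpace M] [ChartedSpace E M] [IsManifold 𝓘(ℝ, E) ∞ M]

/-- The evaluation of covectors at a smooth vector field is smooth. -/
theorem SmoothVField.eval {X : VField (E := E) M} (hX : SmoothVField X) :
    SmoothSection E ((E →L[ℝ] ℝ) →L[ℝ] ℝ)
      (V := fun x : M => (TangentSpace 𝓘(ℝ, E) x →L[ℝ] Bundle.Trivial M ℝ x) →L[ℝ]
        Bundle.Trivial M ℝ x)
      (fun x => (ContinuousLinearMap.apply ℝ ℝ (X x : E) : (E →L[ℝ] ℝ) →L[ℝ] ℝ)) := by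
  intro x₀
  have h2 := (contMDiffAt_section x₀).1 (hX x₀)
  rw [contMDiffAt_hom_bundle]
  refine ⟨contMDiffAt_id, ?_⟩
  have hs : ContDiff ℝ ∞ (fun v : E => (ContinuousLinearMap.apply ℝ ℝ v : (E →L[ℝ] ℝ) →L[ℝ] ℝ)) := by
    fun_prop
  have h3 := hs.contMDiff.contMDiffAt.comp x₀ h2
  refine h3.congr_of_eventuallyEq ?_
  have hb := (trivializationAt E (TangentSpace 𝓘(ℝ, E)) x₀).open_baseSet.mem_nhds
    (FiberBundle.mem_baseSet_trivializationAt' x₀)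
  filter_upwards [hb] with x hx
  ext v
  -- The coordinate covector `v` comes from a genuine covector at `x`. Since `e` acts by
  -- precomposition with the inverse trivialization of the tangent bundle, evaluating `v` at the
  -- coordinates of `X x` gives the value of that covector on `X x`.
  let e := trivializationAt (E →L[ℝ] ℝ)
    (fun b : M => TangentSpace 𝓘(ℝ, E) b →L[ℝ] Bundle.Trivial M ℝ b) x₀
  have hx' : x ∈ e.baseSet := ⟨hx, Set.mem_univ _⟩
  have h5 : (e ⟨x, e.symmL ℝ x v⟩).2 = v := by
    have := e.continuousLinearMapAt_symmL (R := ℝ) hx' v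
    rwa [Trivialization.continuousLinearMapAt_apply, Trivialization.coe_linearMapAt_of_mem _ hx']
      at this
  rw [hom_trivializationAt_apply] at h5
  have h6 := DFunLike.congr_fun h5 (trivializationAt E (TangentSpace 𝓘(ℝ, E)) x₀ ⟨x, X x⟩).2
  have h7 : (trivializationAt E (TangentSpace 𝓘(ℝ, E)) x₀).symmL ℝ x
      (trivializationAt E (TangentSpace 𝓘(ℝ, E)) x₀ ⟨x, X x⟩).2 = X x := by
    have := (trivializationAt E (TangentSpace 𝓘(ℝ, E)) x₀).symmL_continuousLinearMapAt (R := ℝ)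
      hx (X x)
    rwa [Trivialization.continuousLinearMapAt_apply, Trivialization.coe_linearMapAt_of_mem _ hx]
      at this
  simp only [ContinuousLinearMap.inCoordinates, Trivial.fiberBundle_trivializationAt',
    Trivial.continuousLinearMapAt_trivialization, ContinuousLinearMap.comp_apply, h7] at h6 ⊢
  exact h6

end Eval

/-! ### Smooth fields and forms in terms of their components -/

section Invariant

variable {Γ : Subgroup G} [DiscreteTopology Γ]

/-- The inverse trivialization is the differential of the inverse chart, that is, of the covering.
Hence the frame has local expression `leftDiff` in every chart, not only at the centre. -/
theorem chart_symmL {x₀ z : Nil Γ} (hz : z ∈ (chartAt (Fin 5 → ℝ) x₀).source) (v : Fin 5 → ℝ) :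
    (trivializationAt (Fin 5 → ℝ) (TangentSpace 𝓘(ℝ, Fin 5 → ℝ)) x₀).symmL ℝ z
      (leftDiff (extChartAt 𝓘(ℝ, Fin 5 → ℝ) x₀ z) v) = triv Γ z v := by
  have h := TangentBundle.symmL_trivializationAt (I := 𝓘(ℝ, Fin 5 → ℝ)) hz
  have key (f : (Fin 5 → ℝ) → Nil Γ) (hf : f = cover Γ) (y : Fin 5 → ℝ) (hy : cover Γ y = z)
      (A : (Fin 5 → ℝ) →L[ℝ] (Fin 5 → ℝ))
      (hA : A = mfderivWithin 𝓘(ℝ, Fin 5 → ℝ) 𝓘(ℝ, Fin 5 → ℝ) f (Set.range 𝓘(ℝ, Fin 5 → ℝ)) y) :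
      A (leftDiff y v) = triv Γ z v := by
    subst hf hy
    rw [modelWithCornersSelf_coe, Set.range_id, mfderivWithin_univ] at hA
    rw [hA, triv_cover]
    rfl
  exact key _ (extChartAt_symm Γ x₀) _ (cover_extChartAt Γ hz) _ h

theorem smoothVField_triv (v : Fin 5 → ℝ) :
    SmoothVField (fun x : Nil Γ => triv Γ x v) := by
  intro x₀
  rw [contMDiffAt_section]
  have h1 : ContMDiffAt 𝓘(ℝ, Fin 5 → ℝ) 𝓘(ℝ, Fin 5 → ℝ) ∞
      (fun z => leftDiff (extChartAt 𝓘(ℝ, Fin 5 → ℝ) x₀ z) v) x₀ :=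
    (contDiff_leftDiff.clm_apply contDiff_const).contMDiff.contMDiffAt.comp x₀
      (contMDiffAt_extChartAt (I := 𝓘(ℝ, Fin 5 → ℝ)) (x := x₀) (n := ∞))
  refine h1.congr_of_eventuallyEq ?_
  filter_upwards [(chartAt (Fin 5 → ℝ) x₀).open_source.mem_nhds (mem_chart_source _ x₀)] with z hz
  have hz' : z ∈ (trivializationAt (Fin 5 → ℝ) (TangentSpace 𝓘(ℝ, Fin 5 → ℝ)) x₀).baseSet := hz
  have := (trivializationAt (Fin 5 → ℝ) (TangentSpace 𝓘(ℝ, Fin 5 → ℝ))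
    x₀).continuousLinearMapAt_symmL (R := ℝ) hz' (leftDiff (extChartAt 𝓘(ℝ, Fin 5 → ℝ) x₀ z) v)
  rwa [chart_symmL hz, Trivialization.continuousLinearMapAt_apply,
    Trivialization.coe_linearMapAt_of_mem _ hz'] at this

theorem CoverSmooth.smoothOneForm {α : OneForm (E := Fin 5 → ℝ) (Nil Γ)}
    (hα : CoverSmooth (fcomp α)) : SmoothOneForm α := by
  intro x₀
  rw [contMDiffAt_hom_bundle]
  refine ⟨contMDiffAt_id, ?_⟩
  have h1 : ContMDiffAt 𝓘(ℝ, Fin 5 → ℝ) 𝓘(ℝ, (Fin 5 → ℝ) →L[ℝ] ℝ) ∞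
      (fun z => (fcomp α (cover Γ (extChartAt 𝓘(ℝ, Fin 5 → ℝ) x₀ z))).comp
        (leftDiffInv (extChartAt 𝓘(ℝ, Fin 5 → ℝ) x₀ z))) x₀ :=
    (ContDiff.clm_comp hα contDiff_leftDiffInv).contMDiff.contMDiffAt.comp x₀
      (contMDiffAt_extChartAt (I := 𝓘(ℝ, Fin 5 → ℝ)) (x := x₀) (n := ∞))
  refine h1.congr_of_eventuallyEq ?_
  filter_upwards [(chartAt (Fin 5 → ℝ) x₀).open_source.mem_nhds (mem_chart_source _ x₀)] with z hz
  have h2 := fun v => chart_symmL hz (leftDiffInv (extChartAt 𝓘(ℝ, Fin 5 → ℝ) x₀ z) v)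
  simp only [leftDiff_leftDiffInv] at h2
  rw [cover_extChartAt Γ hz]
  ext1 v
  rw [ContinuousLinearMap.comp_apply, fcomp_apply, ← h2]
  simp only [ContinuousLinearMap.inCoordinates, Trivial.fiberBundle_trivializationAt',
    Trivial.continuousLinearMapAt_trivialization, ContinuousLinearMap.comp_apply]
  rfl

theorem fcomp_coframe (i : Fin 5) (x : Nil Γ) :
    fcomp (coframe Γ i) x = ContinuousLinearMap.proj (R := ℝ) (φ := fun _ : Fin 5 => ℝ) i := by
  ext1 v
  rw [fcomp_apply, coframe_apply, ← trivEquiv_apply, ContinuousLinearEquiv.symm_apply_apply]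
  rfl

theorem smoothVField_frame (i : Fin 5) : SmoothVField (frame Γ i) :=
  smoothVField_triv (Pi.single i 1)

theorem smoothOneForm_coframe (i : Fin 5) : SmoothOneForm (coframe Γ i) := by
  apply CoverSmooth.smoothOneForm
  simp only [CoverSmooth, fcomp_coframe]
  exact contDiff_const

theorem coverSmooth_apply {α : OneForm (E := Fin 5 → ℝ) (Nil Γ)}
    {X : VField (E := Fin 5 → ℝ) (Nil Γ)} (hα : SmoothOneForm α) (hX : SmoothVField X) :
    CoverSmooth (fun x => α x (X x)) := by
  apply coverSmooth_of_contMDiff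
  have h := ContMDiff.clm_bundle_apply (b := fun x : Nil Γ => x) hα hX
  exact fun x => (contMDiffAt_section x).1 (h x)

theorem SmoothVField.coverSmooth {X : VField (E := Fin 5 → ℝ) (Nil Γ)} (hX : SmoothVField X) :
    CoverSmooth (vcomp X) := by
  rw [CoverSmooth, contDiff_pi]
  intro i
  have h := coverSmooth_apply (smoothOneForm_coframe i) hX
  simp only [coframe_apply] at h
  exact h

theorem SmoothOneForm.coverSmooth {α : OneForm (E := Fin 5 → ℝ) (Nil Γ)} (hα : SmoothOneForm α) :
    CoverSmooth (fcomp α) := by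
  rw [CoverSmooth, contDiff_clm_apply_iff]
  intro v
  exact coverSmooth_apply hα (smoothVField_triv v)

end Invariant

/-! ### The Courant bracket in the invariant frame -/

section CourantComponents

variable {Γ : Subgroup G} [DiscreteTopology Γ]

theorem invDeriv_apply_vcomp {α : OneForm (E := Fin 5 → ℝ) (Nil Γ)}
    {X : VField (E := Fin 5 → ℝ) (Nil Γ)} (hα : CoverSmooth (fcomp α)) (hX : CoverSmooth (vcomp X))
    (x : Nil Γ) (u : Fin 5 → ℝ) :
    invDeriv (fun z => α z (X z)) x u
      = invDeriv (fcomp α) x u (vcomp X x) + fcomp α x (invDeriv (vcomp X) x u) := by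
  have h : (fun y => α (cover Γ y) (X (cover Γ y)))
      = fun y => fcomp α (cover Γ y) (vcomp X (cover Γ y)) := by
    funext y
    rw [fcomp_vcomp]
  rw [invDeriv, ContinuousLinearMap.comp_apply, h, ((hα.differentiable _).hasFDerivAt.clm_apply
    (hX.differentiable _).hasFDerivAt).fderiv]
  simp [invDeriv, cover_center, add_comm]

theorem CoverSmooth.apply {α : OneForm (E := Fin 5 → ℝ) (Nil Γ)}
    {X : VField (E := Fin 5 → ℝ) (Nil Γ)} (hα : CoverSmooth (fcomp α))
    (hX : CoverSmooth (vcomp X)) : CoverSmooth (fun z => α z (X z)) := by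
  have h := ContDiff.clm_apply hα hX
  simp only [fcomp_vcomp] at h
  exact h

theorem lieDer_triv {α : OneForm (E := Fin 5 → ℝ) (Nil Γ)}
    {X : VField (E := Fin 5 → ℝ) (Nil Γ)} (hα : CoverSmooth (fcomp α)) (hX : CoverSmooth (vcomp X))
    (x : Nil Γ) (u : Fin 5 → ℝ) :
    lieDer X α x (triv Γ x u) = invDeriv (fcomp α) x (vcomp X x) u
      + fcomp α x (invDeriv (vcomp X) x u) - fcomp α x (lieBr (vcomp X x) u) := by
  have h1 : lieDer X α x (triv Γ x u)
      = dFun (fun y => α y (X y)) x (triv Γ x u) + dForm α x (X x) (triv Γ x u) := rfl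
  rw [h1, dFun_triv (hα.apply hX), invDeriv_apply_vcomp hα hX, ← triv_vcomp X x, dForm_triv hα]
  ring

/-- Smoothness of a section of `TM ⊕ T*M`, tested on its components. -/
structure CoverSmoothPair (s : GenSection (E := Fin 5 → ℝ) (Nil Γ)) : Prop where
  vec : CoverSmooth (vcomp fun y => (s y).1)
  form : CoverSmooth (fcomp fun y => (s y).2)

theorem SmoothGenSection.coverSmoothPair {s : GenSection (E := Fin 5 → ℝ) (Nil Γ)}
    (hs : SmoothGenSection s) : CoverSmoothPair s :=
  ⟨hs.1.coverSmooth, hs.2.coverSmooth⟩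

/-- The components of the vector part. -/
abbrev vc (s : GenSection (E := Fin 5 → ℝ) (Nil Γ)) : Nil Γ → Fin 5 → ℝ :=
  vcomp fun y => (s y).1

/-- The components of the covector part. -/
abbrev fc (s : GenSection (E := Fin 5 → ℝ) (Nil Γ)) : Nil Γ → (Fin 5 → ℝ) →L[ℝ] ℝ :=
  fcomp fun y => (s y).2

theorem vc_courant {s t : GenSection (E := Fin 5 → ℝ) (Nil Γ)} (hs : CoverSmoothPair s)
    (ht : CoverSmoothPair t) (x : Nil Γ) :
    vc (courant s t) x = invDeriv (vc t) x (vc s x) - invDeriv (vc s) x (vc t x)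
      + lieBr (vc s x) (vc t x) :=
  vcomp_mlieBracket hs.vec ht.vec x

/-- The term `-(1/2) d(β(X) - α(Y))` removes half of the derivatives of `β(X)` and `α(Y)`
contributed by the Lie derivatives. The remainder is antisymmetric in the two sections and pairs
each with a derivative of the other, the form in which isotropy applies. -/
theorem fc_courant {s t : GenSection (E := Fin 5 → ℝ) (Nil Γ)} (hs : CoverSmoothPair s)
    (ht : CoverSmoothPair t) (x : Nil Γ) (u : Fin 5 → ℝ) :
    fc (courant s t) x u = invDeriv (fc t) x (vc s x) u - invDeriv (fc s) x (vc t x) u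
      - fc t x (lieBr (vc s x) u) + fc s x (lieBr (vc t x) u)
      + (1 / 2) * (fc t x (invDeriv (vc s) x u) + invDeriv (fc s) x u (vc t x)
        - (invDeriv (fc t) x u (vc s x) + fc s x (invDeriv (vc t) x u))) := by
  have h1 : fc (courant s t) x u
      = lieDer (fun y => (s y).1) (fun y => (t y).2) x (triv Γ x u)
        - lieDer (fun y => (t y).1) (fun y => (s y).2) x (triv Γ x u)
        - (1 / 2) * dFun (fun y => (t y).2 (s y).1 - (s y).2 (t y).1) x (triv Γ x u) := rfl
  have hts := ht.form.apply hs.vec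
  have hst := hs.form.apply ht.vec
  have hsub : CoverSmooth (fun y => (t y).2 (s y).1 - (s y).2 (t y).1) := ContDiff.sub hts hst
  have h2 : invDeriv (fun y => (t y).2 (s y).1 - (s y).2 (t y).1) x u
      = invDeriv (fun y => (t y).2 (s y).1) x u - invDeriv (fun y => (s y).2 (t y).1) x u := by
    simp only [invDeriv, ContinuousLinearMap.comp_apply]
    rw [fderiv_fun_sub (hts.differentiable _) (hst.differentiable _)]
    rfl
  rw [h1, lieDer_triv ht.form hs.vec, lieDer_triv hs.form ht.vec, dFun_triv hsub,
    h2, invDeriv_apply_vcomp ht.form hs.vec, invDeriv_apply_vcomp hs.form ht.vec]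
  ring

end CourantComponents

/-! ### The interpolating tensors and the fibres of `L` -/

section Family

variable (Γ : Subgroup G) [DiscreteTopology Γ]

/-- The invariant tensors interpolating between `J₀` and `J₁`. -/
def interpolation (c s : ℝ) : Tensors (E := Fin 5 → ℝ) (Nil Γ) where
  F := frame Γ 4
  eta := coframe Γ 4
  pi x := s • (J₁ Γ).pi x
  theta x := s • (J₁ Γ).theta x
  phi x := c • (J₀ Γ).phi x

variable {Γ}

theorem tangent_ext {x : Nil Γ} {X Y : TangentSpace 𝓘(ℝ, Fin 5 → ℝ) x}
    (h : ∀ i, coframe Γ i x X = coframe Γ i x Y) : X = Y := by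
  apply (trivEquiv Γ x).symm.injective
  ext i
  rw [← coframe_apply, ← coframe_apply, h]

theorem covector_apply {x : Nil Γ} (α : CotSpace (E := Fin 5 → ℝ) x)
    (X : TangentSpace 𝓘(ℝ, Fin 5 → ℝ) x) :
    α X = ∑ i, coframe Γ i x X * α (frame Γ i x) := by
  have h : X = ∑ i, coframe Γ i x X • frame Γ i x := by
    apply tangent_ext
    intro j
    simp [coframe_frame]
  conv_lhs => rw [h]
  simp

theorem covector_ext {x : Nil Γ} {α β : CotSpace (E := Fin 5 → ℝ) x}
    (h : ∀ i, α (frame Γ i x) = β (frame Γ i x)) : α = β := by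
  ext1 X
  rw [covector_apply α, covector_apply β]
  simp only [h]

theorem coframe_Phi (c s : ℝ) (x : Nil Γ)
    (e : TangentSpace 𝓘(ℝ, Fin 5 → ℝ) x × CotSpace (E := Fin 5 → ℝ) x) (i : Fin 5) :
    coframe Γ i x ((interpolation Γ c s).Phi x e).1
      = ![-(c * coframe Γ 1 x e.1) - s * e.2 (frame Γ 2 x),
          c * coframe Γ 0 x e.1 + s * e.2 (frame Γ 3 x),
          -(c * coframe Γ 3 x e.1) + s * e.2 (frame Γ 0 x),
          c * coframe Γ 2 x e.1 - s * e.2 (frame Γ 1 x), 0] i := by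
  have h : ((interpolation Γ c s).Phi x e).1
      = c • (coframe Γ 0 x e.1 • frame Γ 1 x - coframe Γ 1 x e.1 • frame Γ 0 x
          + coframe Γ 2 x e.1 • frame Γ 3 x - coframe Γ 3 x e.1 • frame Γ 2 x)
        + s • ((e.2 (frame Γ 0 x) • frame Γ 2 x - e.2 (frame Γ 2 x) • frame Γ 0 x)
          - (e.2 (frame Γ 1 x) • frame Γ 3 x - e.2 (frame Γ 3 x) • frame Γ 1 x)) := rfl
  rw [h]
  fin_cases i <;> simp [coframe_frame] <;> ring

theorem Phi_frame (c s : ℝ) (x : Nil Γ)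
    (e : TangentSpace 𝓘(ℝ, Fin 5 → ℝ) x × CotSpace (E := Fin 5 → ℝ) x) (i : Fin 5) :
    ((interpolation Γ c s).Phi x e).2 (frame Γ i x)
      = ![-(c * e.2 (frame Γ 1 x)) - s * coframe Γ 2 x e.1,
          c * e.2 (frame Γ 0 x) + s * coframe Γ 3 x e.1,
          -(c * e.2 (frame Γ 3 x)) + s * coframe Γ 0 x e.1,
          c * e.2 (frame Γ 2 x) - s * coframe Γ 1 x e.1, 0] i := by
  have h : ((interpolation Γ c s).Phi x e).2 (frame Γ i x)
      = s * ((coframe Γ 0 x e.1 * coframe Γ 2 x (frame Γ i x)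
            - coframe Γ 2 x e.1 * coframe Γ 0 x (frame Γ i x))
          - (coframe Γ 1 x e.1 * coframe Γ 3 x (frame Γ i x)
            - coframe Γ 3 x e.1 * coframe Γ 1 x (frame Γ i x)))
        - e.2 (c • (coframe Γ 0 x (frame Γ i x) • frame Γ 1 x
          - coframe Γ 1 x (frame Γ i x) • frame Γ 0 x
          + coframe Γ 2 x (frame Γ i x) • frame Γ 3 x
          - coframe Γ 3 x (frame Γ i x) • frame Γ 2 x)) := rfl
  rw [h]
  fin_cases i <;> simp [coframe_frame] <;> ring

/-- Skewness is linear in `(c, s)`, so no relation between them is needed. -/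
theorem interpolation_skew (c s : ℝ) (x : Nil Γ)
    (e e' : TangentSpace 𝓘(ℝ, Fin 5 → ℝ) x × CotSpace (E := Fin 5 → ℝ) x) :
    pairing ((interpolation Γ c s).Phi x e) e' + pairing e ((interpolation Γ c s).Phi x e') = 0 := by
  simp only [pairing]
  rw [covector_apply e'.2, covector_apply e.2, covector_apply ((interpolation Γ c s).Phi x e).2,
    covector_apply ((interpolation Γ c s).Phi x e').2]
  simp only [coframe_Phi, Phi_frame, Fin.sum_univ_five]
  simp
  ring

theorem interpolation_Phi_F (c s : ℝ) (x : Nil Γ) :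
    (interpolation Γ c s).Phi x (frame Γ 4 x, 0) = 0 := by
  apply Prod.ext
  · apply tangent_ext
    intro i
    rw [coframe_Phi]
    fin_cases i <;> simp [coframe_frame]
  · apply covector_ext
    intro i
    rw [Phi_frame]
    fin_cases i <;> simp [coframe_frame]

theorem interpolation_Phi_eta (c s : ℝ) (x : Nil Γ) :
    (interpolation Γ c s).Phi x (0, coframe Γ 4 x) = 0 := by
  apply Prod.ext
  · apply tangent_ext
    intro i
    rw [coframe_Phi]
    fin_cases i <;> simp [coframe_frame]
  · apply covector_ext
    intro i
    rw [Phi_frame]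
    fin_cases i <;> simp [coframe_frame]

/-- The cross terms in `cs` cancel because the two endomorphisms anticommute; the squares add up to
`-(c² + s²)` off the `F` and `η` directions. -/
theorem interpolation_Phi_Phi {c s : ℝ} (hcs : c ^ 2 + s ^ 2 = 1) (x : Nil Γ)
    (e : TangentSpace 𝓘(ℝ, Fin 5 → ℝ) x × CotSpace (E := Fin 5 → ℝ) x) :
    (interpolation Γ c s).Phi x ((interpolation Γ c s).Phi x e)
      = -e + (coframe Γ 4 x e.1 • frame Γ 4 x, e.2 (frame Γ 4 x) • coframe Γ 4 x) := by
  apply Prod.ext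
  · apply tangent_ext
    intro i
    simp only [coframe_Phi, Phi_frame]
    fin_cases i <;> simp [coframe_frame]
    · linear_combination (-coframe Γ 0 x e.1) * hcs
    · linear_combination (-coframe Γ 1 x e.1) * hcs
    · linear_combination (-coframe Γ 2 x e.1) * hcs
    · linear_combination (-coframe Γ 3 x e.1) * hcs
  · apply covector_ext
    intro i
    simp only [coframe_Phi, Phi_frame]
    fin_cases i <;> simp [coframe_frame]
    · linear_combination (-e.2 (frame Γ 0 x)) * hcs
    · linear_combination (-e.2 (frame Γ 1 x)) * hcs
    · linear_combination (-e.2 (frame Γ 2 x)) * hcs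
    · linear_combination (-e.2 (frame Γ 3 x)) * hcs

/-- The components of the fibre of `L`: here `(p, p')` and `(q, q')` are the components of the
real and of the imaginary part. -/
structure ModelL (c s : ℝ) (p p' q q' : Fin 5 → ℝ) : Prop where
  p4 : p' 4 = 0
  q4 : q' 4 = 0
  v0 : q 0 = c * p 1 + s * p' 2
  v1 : q 1 = -(c * p 0) - s * p' 3
  v2 : q 2 = c * p 3 - s * p' 0
  v3 : q 3 = -(c * p 2) + s * p' 1
  f0 : q' 0 = c * p' 1 + s * p 2
  f1 : q' 1 = -(c * p' 0) - s * p 3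
  f2 : q' 2 = c * p' 3 - s * p 0
  f3 : q' 3 = -(c * p' 2) + s * p 1

theorem memL_interpolation_iff (c s : ℝ) (x : Nil Γ)
    (a b : TangentSpace 𝓘(ℝ, Fin 5 → ℝ) x × CotSpace (E := Fin 5 → ℝ) x) :
    (interpolation Γ c s).MemL x a b ↔ ModelL c s (fun i => coframe Γ i x a.1)
      (fun i => a.2 (frame Γ i x)) (fun i => coframe Γ i x b.1) (fun i => b.2 (frame Γ i x)) := by
  have hF : (interpolation Γ c s).F x = frame Γ 4 x := rfl
  have heta : (interpolation Γ c s).eta x = coframe Γ 4 x := rfl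
  constructor
  · rintro ⟨r, r', e, h1, h2, rfl, rfl⟩
    rw [hF] at *
    rw [heta] at h1
    constructor <;>
    simp [coframe_Phi, Phi_frame, coframe_frame, h2] <;> ring
  · intro h
    -- The multiples of `F` are the `e₅`-components of `a` and `b`, and `e` is what remains of the
    -- real part `a`. The equations of `ModelL` then say that `b` is determined by `e` up to its
    -- `e₅`-component.
    refine ⟨coframe Γ 4 x a.1, coframe Γ 4 x b.1,
      (a.1 - coframe Γ 4 x a.1 • frame Γ 4 x, a.2), ?_, h.p4, ?_, ?_⟩
    · rw [heta]
      simp [coframe_frame]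
    · apply Prod.ext
      · simp [hF]
      · simp
    · apply Prod.ext
      · apply tangent_ext
        intro i
        have h0 := h.v0
        have h1 := h.v1
        have h2 := h.v2
        have h3 := h.v3
        simp only [hF, Prod.fst_sub, map_sub, coframe_Phi]
        fin_cases i <;> simp [coframe_frame, *] <;> ring
      · apply covector_ext
        intro i
        have h0 := h.f0
        have h1 := h.f1
        have h2 := h.f2
        have h3 := h.f3
        have h4 := h.q4
        have h5 := h.p4
        simp only [hF, Prod.snd_sub, sub_apply, Phi_frame]
        fin_cases i <;> simp [coframe_frame, *] <;> ring

end Family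

/-! ## Integrability -/

section Algebra

variable {c s : ℝ} {p p' q q' r r' t t' : Fin 5 → ℝ}

theorem ModelL.add (h : ModelL c s p p' q q') (k : ModelL c s r r' t t') :
    ModelL c s (p + r) (p' + r') (q + t) (q' + t') := by
  constructor <;> simp only [Pi.add_apply, h.p4, h.q4, h.v0, h.v1, h.v2, h.v3, h.f0, h.f1, h.f2,
    h.f3, k.p4, k.q4, k.v0, k.v1, k.v2, k.v3, k.f0, k.f1, k.f2, k.f3] <;> ring

theorem ModelL.sub (h : ModelL c s p p' q q') (k : ModelL c s r r' t t') :
    ModelL c s (p - r) (p' - r') (q - t) (q' - t') := by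
  constructor <;> simp only [Pi.sub_apply, h.p4, h.q4, h.v0, h.v1, h.v2, h.v3, h.f0, h.f1, h.f2,
    h.f3, k.p4, k.q4, k.v0, k.v1, k.v2, k.v3, k.f0, k.f1, k.f2, k.f3] <;> ring

/-- The fibre of `L` is stable under multiplication by `i`. -/
theorem ModelL.mul_I (hcs : c ^ 2 + s ^ 2 = 1) (h : ModelL c s p p' q q') :
    ModelL c s (-q) (-q') p p' := by
  constructor <;> simp only [Pi.neg_apply, h.p4, h.q4, h.v0, h.v1, h.v2, h.v3, h.f0, h.f1, h.f2,
    h.f3, neg_zero]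
  · linear_combination (-p 0) * hcs
  · linear_combination (-p 1) * hcs
  · linear_combination (-p 2) * hcs
  · linear_combination (-p 3) * hcs
  · linear_combination (-p' 0) * hcs
  · linear_combination (-p' 1) * hcs
  · linear_combination (-p' 2) * hcs
  · linear_combination (-p' 3) * hcs

/-- The pairing of the components of two elements of `TM ⊕ T*M`. -/
def modelPair (p p' r r' : Fin 5 → ℝ) : ℝ := ∑ i, (p i * r' i + p' i * r i)

/-- The fibre of `L` is isotropic: the real part. -/
theorem ModelL.isotropic_re (hcs : c ^ 2 + s ^ 2 = 1) (h : ModelL c s p p' q q')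
    (k : ModelL c s r r' t t') : modelPair p p' r r' - modelPair q q' t t' = 0 := by
  simp only [modelPair, Fin.sum_univ_five, h.p4, h.q4, h.v0, h.v1, h.v2, h.v3, h.f0, h.f1, h.f2,
    h.f3, k.p4, k.q4, k.v0, k.v1, k.v2, k.v3, k.f0, k.f1, k.f2, k.f3]
  linear_combination (-(p 0 * r' 0 + p' 0 * r 0 + p 1 * r' 1 + p' 1 * r 1 + p 2 * r' 2
    + p' 2 * r 2 + p 3 * r' 3 + p' 3 * r 3)) * hcs

/-- The fibre of `L` is isotropic: the imaginary part. -/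
theorem ModelL.isotropic_im (h : ModelL c s p p' q q')
    (k : ModelL c s r r' t t') : modelPair p p' t t' + modelPair q q' r r' = 0 := by
  simp only [modelPair, Fin.sum_univ_five, h.p4, h.q4, h.v0, h.v1, h.v2, h.v3, h.f0, h.f1, h.f2,
    h.f3, k.p4, k.q4, k.v0, k.v1, k.v2, k.v3, k.f0, k.f1, k.f2, k.f3]
  ring

/-- The components of the covector `u ↦ α ([v, u])`. -/
def coad (v α : Fin 5 → ℝ) : Fin 5 → ℝ :=
  ![-(v 1 * α 2) + v 2 * α 4, v 0 * α 2 - v 3 * α 4, -(v 0 * α 4), v 1 * α 4, 0]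

set_option linter.unusedSimpArgs false in
/-- The space of invariant sections of `L` is closed under the Courant bracket. -/
theorem ModelL.bracket (hcs : c ^ 2 + s ^ 2 = 1) (h : ModelL c s p p' q q')
    (k : ModelL c s r r' t t') :
    ModelL c s (lieBr p r - lieBr q t)
      ((coad r p' - coad p r') - (coad t q' - coad q t'))
      (lieBr p t + lieBr q r)
      ((coad t p' - coad p t') + (coad r q' - coad q r')) := by
  -- As the covectors vanish on `e₅`, only `[e₁, e₂] = e₃` contributes, and the only conditions with
  -- content are `v2`, `v3`, `f0`, `f1`. The four multiples of `hcs` serve these.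
  constructor <;> simp [coad, lieBr, h.p4, h.q4, h.v0, h.v1, h.v2, h.v3, h.f0, h.f1, h.f2,
    h.f3, k.p4, k.q4, k.v0, k.v1, k.v2, k.v3, k.f0, k.f1, k.f2, k.f3] <;> first
    | ring1
    | linear_combination (s * (p 0 * r' 3 - r 0 * p' 3)) * hcs
    | linear_combination (c * (p 1 * r 0 - p 0 * r 1) + s * (r 0 * p' 2 - p 0 * r' 2)) * hcs
    | linear_combination (c * (r 1 * p' 3 - r' 3 * p 1) + s * (p' 3 * r' 2 - r' 3 * p' 2)) * hcs
    | linear_combination (c * (p 0 * r' 3 - r 0 * p' 3)) * hcs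

end Algebra

/-! ### From invariant sections of `L` to all smooth sections -/

section Closed

variable {Γ : Subgroup G} [DiscreteTopology Γ]

/-- The components of the covector part of a section, as a vector. -/
def fv (a : GenSection (E := Fin 5 → ℝ) (Nil Γ)) (x : Nil Γ) : Fin 5 → ℝ :=
  fun i => fc a x (Pi.single i 1)

theorem clm_eq_sum (α : (Fin 5 → ℝ) →L[ℝ] ℝ) (v : Fin 5 → ℝ) :
    α v = ∑ i, v i * α (Pi.single i 1) := by
  conv_lhs => rw [← Finset.univ_sum_single v]
  rw [map_sum]
  refine Finset.sum_congr rfl fun i _ => ?_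
  rw [← smul_eq_mul, ← map_smul, ← Pi.single_smul', smul_eq_mul, mul_one]

theorem CoverSmoothPair.fv {a : GenSection (E := Fin 5 → ℝ) (Nil Γ)} (ha : CoverSmoothPair a) :
    CoverSmooth (fv a) := by
  have h := ha.form
  rw [CoverSmooth, contDiff_clm_apply_iff] at h
  rw [CoverSmooth, contDiff_pi]
  exact fun i => h (Pi.single i 1)

theorem invDeriv_fc {a : GenSection (E := Fin 5 → ℝ) (Nil Γ)} (ha : CoverSmoothPair a)
    (x : Nil Γ) (w : Fin 5 → ℝ) (i : Fin 5) :
    invDeriv (fc a) x w (Pi.single i 1) = invDeriv (fv a) x w i := by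
  have h1 := ((ha.form.differentiable (center Γ x)).hasFDerivAt.clm_apply
    (hasFDerivAt_const (Pi.single i (1 : ℝ) : Fin 5 → ℝ) (center Γ x))).fderiv
  have h2 := fderiv_pi (fun j => ((differentiableAt_pi.1 (ha.fv.differentiable (center Γ x))) j))
  have h3 := congrArg (fun A : (Fin 5 → ℝ) →L[ℝ] (Fin 5 → ℝ) =>
    A (leftDiff (center Γ x) w) i) h2
  have h4 := DFunLike.congr_fun h1 (leftDiff (center Γ x) w)
  simp only [ContinuousLinearMap.comp_zero, zero_add] at h4
  exact h4.symm.trans h3.symm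

/-- Every equation of `ModelL` has this two-term shape with constant coefficients, so it can be
differentiated along any invariant direction. -/
theorem invDeriv_lin {f g h : Nil Γ → Fin 5 → ℝ} (hf : CoverSmooth f) (hg : CoverSmooth g)
    (hh : CoverSmooth h) (i j k : Fin 5) (c d : ℝ) (he : ∀ z, f z i = c * g z j + d * h z k)
    (x : Nil Γ) (w : Fin 5 → ℝ) :
    invDeriv f x w i = c * invDeriv g x w j + d * invDeriv h x w k := by
  have hp {f : Nil Γ → Fin 5 → ℝ} (hf : CoverSmooth f) (i : Fin 5) :=
    hasFDerivAt_pi'.1 (hf.differentiable (center Γ x)).hasFDerivAt i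
  have h1 := ((hp hg j).const_mul c).add ((hp hh k).const_mul d)
  have h2 : (fun y => f (cover Γ y) i)
      = (fun y => c * g (cover Γ y) j) + fun y => d * h (cover Γ y) k := by
    funext y
    exact he _
  have h3 := hp hf i
  rw [h2] at h3
  exact DFunLike.congr_fun (h3.unique h1) (leftDiff (center Γ x) w)

theorem modelL_invDeriv {c s : ℝ} {a b : GenSection (E := Fin 5 → ℝ) (Nil Γ)}
    (ha : CoverSmoothPair a) (hb : CoverSmoothPair b)
    (h : ∀ x, ModelL c s (vc a x) (fv a x) (vc b x) (fv b x)) (x : Nil Γ) (w : Fin 5 → ℝ) :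
    ModelL c s (invDeriv (vc a) x w) (invDeriv (fv a) x w) (invDeriv (vc b) x w)
      (invDeriv (fv b) x w) where
  -- With both coefficients zero the relation says that the component vanishes; the remaining
  -- functions and indices are placeholders.
  p4 := by
    simpa using invDeriv_lin ha.fv ha.fv ha.fv 4 4 4 0 0 (fun z => by simp [(h z).p4]) x w
  q4 := by
    simpa using invDeriv_lin hb.fv hb.fv hb.fv 4 4 4 0 0 (fun z => by simp [(h z).q4]) x w
  v0 := invDeriv_lin hb.vec ha.vec ha.fv 0 1 2 c s (fun z => (h z).v0) x w
  v1 := by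
    have := invDeriv_lin hb.vec ha.vec ha.fv 1 0 3 (-c) (-s)
      (fun z => by linear_combination (h z).v1) x w
    rw [this]; ring
  v2 := by
    have := invDeriv_lin hb.vec ha.vec ha.fv 2 3 0 c (-s)
      (fun z => by linear_combination (h z).v2) x w
    rw [this]; ring
  v3 := by
    have := invDeriv_lin hb.vec ha.vec ha.fv 3 2 1 (-c) s
      (fun z => by linear_combination (h z).v3) x w
    rw [this]; ring
  f0 := invDeriv_lin hb.fv ha.fv ha.vec 0 1 2 c s (fun z => (h z).f0) x w
  f1 := by
    have := invDeriv_lin hb.fv ha.fv ha.vec 1 0 3 (-c) (-s)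
      (fun z => by linear_combination (h z).f1) x w
    rw [this]; ring
  f2 := by
    have := invDeriv_lin hb.fv ha.fv ha.vec 2 3 0 c (-s)
      (fun z => by linear_combination (h z).f2) x w
    rw [this]; ring
  f3 := by
    have := invDeriv_lin hb.fv ha.fv ha.vec 3 2 1 (-c) s
      (fun z => by linear_combination (h z).f3) x w
    rw [this]; ring

/-- This turns the bracket terms of `fc_courant` into the coadjoint expressions of `ModelL.bracket`.
-/
theorem fc_lieBr (a : GenSection (E := Fin 5 → ℝ) (Nil Γ)) (x : Nil Γ) (v : Fin 5 → ℝ)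
    (i : Fin 5) : fc a x (lieBr v (Pi.single i 1)) = coad v (fv a x) i := by
  rw [clm_eq_sum, Fin.sum_univ_five]
  fin_cases i <;> simp [lieBr, coad, fv, sub_eq_add_neg]

/-- The covector part of the Courant bracket in components. -/
theorem fv_courant {a b : GenSection (E := Fin 5 → ℝ) (Nil Γ)} (ha : CoverSmoothPair a)
    (hb : CoverSmoothPair b) (x : Nil Γ) (i : Fin 5) :
    fv (courant a b) x i = invDeriv (fv b) x (vc a x) i - invDeriv (fv a) x (vc b x) i
      - coad (vc a x) (fv b x) i + coad (vc b x) (fv a x) i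
      + (1 / 2) * (modelPair (invDeriv (vc a) x (Pi.single i 1)) (invDeriv (fv a) x (Pi.single i 1))
          (vc b x) (fv b x)
        - modelPair (invDeriv (vc b) x (Pi.single i 1)) (invDeriv (fv b) x (Pi.single i 1))
          (vc a x) (fv a x)) := by
  have key {a b : GenSection (E := Fin 5 → ℝ) (Nil Γ)} (ha : CoverSmoothPair a) :
      fc b x (invDeriv (vc a) x (Pi.single i 1)) + invDeriv (fc a) x (Pi.single i 1) (vc b x)
        = modelPair (invDeriv (vc a) x (Pi.single i 1)) (invDeriv (fv a) x (Pi.single i 1))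
          (vc b x) (fv b x) := by
    rw [clm_eq_sum (fc b x), clm_eq_sum (invDeriv (fc a) x (Pi.single i 1)),
      ← Finset.sum_add_distrib, modelPair]
    refine Finset.sum_congr rfl fun j _ => ?_
    rw [invDeriv_fc ha, fv]
    ring
  have h := fc_courant ha hb x (Pi.single i 1)
  rw [key ha, add_comm (invDeriv (fc b) x _ _), key hb, invDeriv_fc ha, invDeriv_fc hb, fc_lieBr,
    fc_lieBr] at h
  exact h

theorem memL_iff_modelL (c s : ℝ) (a b : GenSection (E := Fin 5 → ℝ) (Nil Γ)) (x : Nil Γ) :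
    (interpolation Γ c s).MemL x (a x) (b x) ↔ ModelL c s (vc a x) (fv a x) (vc b x) (fv b x) := by
  rw [memL_interpolation_iff]
  simp only [coframe_apply]
  exact Iff.rfl

theorem interpolation_courantClosed {c s : ℝ} (hcs : c ^ 2 + s ^ 2 = 1) :
    (interpolation Γ c s).CourantClosed := by
  intro a b a' b' ha hb ha' hb' hab hab' x
  replace ha := ha.coverSmoothPair
  replace hb := hb.coverSmoothPair
  replace ha' := ha'.coverSmoothPair
  replace hb' := hb'.coverSmoothPair
  simp only [memL_iff_modelL] at hab hab'
  refine (memL_iff_modelL c s (fun x => courant a a' x - courant b b' x)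
    (fun x => courant a b' x + courant b a' x) x).2 ?_
  have hD (w : Fin 5 → ℝ) := modelL_invDeriv ha hb hab x w
  have hD' (w : Fin 5 → ℝ) := modelL_invDeriv ha' hb' hab' x w
  -- For `A = a + ib` and `A' = a' + ib'` this is `D_A A' - D_{A'} A` plus the bracket of the values
  -- at `x` taken as invariant sections. Differentiation along the imaginary part enters through
  -- multiplication by `i`.
  have hmain := (((hD' (vc a x)).add ((hD' (vc b x)).mul_I hcs)).sub
    ((hD (vc a' x)).add ((hD (vc b' x)).mul_I hcs))).add ((hab x).bracket hcs (hab' x))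
  have hv (s t : GenSection (E := Fin 5 → ℝ) (Nil Γ)) :
      vc (fun x => s x - t x) x = vc s x - vc t x := map_sub (trivEquiv Γ x).symm _ _
  have hv' (s t : GenSection (E := Fin 5 → ℝ) (Nil Γ)) :
      vc (fun x => s x + t x) x = vc s x + vc t x := map_add (trivEquiv Γ x).symm _ _
  have hf (s t : GenSection (E := Fin 5 → ℝ) (Nil Γ)) :
      fv (fun x => s x - t x) x = fv s x - fv t x := rfl
  have hf' (s t : GenSection (E := Fin 5 → ℝ) (Nil Γ)) :
      fv (fun x => s x + t x) x = fv s x + fv t x := rfl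
  rw [hv, hv', hf, hf', vc_courant ha ha', vc_courant hb hb', vc_courant ha hb', vc_courant hb ha']
  convert! hmain using 1
  · abel
  · ext i
    -- What `hmain` leaves over is half the difference of the pairings of `D_i A` with `A'` and of
    -- `D_i A'` with `A`. Both vanish, since all four elements lie in the isotropic fibre.
    have h1 := (hD (Pi.single i 1)).isotropic_re hcs (hab' x)
    have h2 := (hD' (Pi.single i 1)).isotropic_re hcs (hab x)
    simp only [Pi.sub_apply, Pi.add_apply, Pi.neg_apply, fv_courant ha ha', fv_courant hb hb']
    linear_combination (1 / 2) * h1 - (1 / 2) * h2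
  · abel
  · ext i
    have h1 := (hD (Pi.single i 1)).isotropic_im (hab' x)
    have h2 := (hD' (Pi.single i 1)).isotropic_im (hab x)
    simp only [Pi.sub_apply, Pi.add_apply, fv_courant ha hb', fv_courant hb ha']
    linear_combination (1 / 2) * h1 - (1 / 2) * h2

end Closed

section Deformation

variable {Γ : Subgroup G} [DiscreteTopology Γ]

/-! ## Smoothness of the family -/

theorem smoothSection_phi : SmoothSection (Fin 5 → ℝ) ((Fin 5 → ℝ) →L[ℝ] (Fin 5 → ℝ))
    (V := fun x : Nil Γ => TangentSpace 𝓘(ℝ, Fin 5 → ℝ) x →L[ℝ] TangentSpace 𝓘(ℝ, Fin 5 → ℝ) x)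
    (J₀ Γ).phi := by
  have h (i j : Fin 5) := SmoothSection.smulRight (smoothOneForm_coframe (Γ := Γ) i)
    (smoothVField_frame (Γ := Γ) j)
  exact (((h 0 1).sub_section (h 1 0)).add_section (h 2 3)).sub_section (h 3 2)

theorem smoothSection_theta : SmoothSection (Fin 5 → ℝ) ((Fin 5 → ℝ) →L[ℝ] (Fin 5 → ℝ) →L[ℝ] ℝ)
    (V := fun x : Nil Γ => TangentSpace 𝓘(ℝ, Fin 5 → ℝ) x →L[ℝ]
      (TangentSpace 𝓘(ℝ, Fin 5 → ℝ) x →L[ℝ] Bundle.Trivial (Nil Γ) ℝ x))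
    (J₁ Γ).theta := by
  have h (i j : Fin 5) := SmoothSection.smulRight
    (V₂ := fun x : Nil Γ => TangentSpace 𝓘(ℝ, Fin 5 → ℝ) x →L[ℝ] Bundle.Trivial (Nil Γ) ℝ x)
    (smoothOneForm_coframe (Γ := Γ) i) (smoothOneForm_coframe (Γ := Γ) j)
  exact ((h 0 2).sub_section (h 2 0)).sub_section ((h 1 3).sub_section (h 3 1))

theorem smoothSection_pi : SmoothSection (Fin 5 → ℝ) (((Fin 5 → ℝ) →L[ℝ] ℝ) →L[ℝ] (Fin 5 → ℝ))
    (V := fun x : Nil Γ => (TangentSpace 𝓘(ℝ, Fin 5 → ℝ) x →L[ℝ] Bundle.Trivial (Nil Γ) ℝ x) →L[ℝ]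
      TangentSpace 𝓘(ℝ, Fin 5 → ℝ) x)
    (J₁ Γ).pi := by
  have h (i j : Fin 5) := SmoothSection.smulRight
    (V₁ := fun x : Nil Γ => TangentSpace 𝓘(ℝ, Fin 5 → ℝ) x →L[ℝ] Bundle.Trivial (Nil Γ) ℝ x)
    (smoothVField_frame (Γ := Γ) i).eval (smoothVField_frame (Γ := Γ) j)
  exact ((h 0 2).sub_section (h 2 0)).sub_section ((h 1 3).sub_section (h 3 1))

theorem smoothFamily_interpolation {c s : ℝ → ℝ} (hc : ContDiff ℝ ∞ c) (hs : ContDiff ℝ ∞ s) :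
    SmoothFamily (fun t => interpolation Γ (c t) (s t)) where
  F := (smoothVField_frame (Γ := Γ) 4).comp contMDiff_snd
  eta := (smoothOneForm_coframe (Γ := Γ) 4).comp contMDiff_snd
  pi := SmoothSection.smul_param smoothSection_pi hs
  theta := SmoothSection.smul_param (V₁ := fun x : Nil Γ => TangentSpace 𝓘(ℝ, Fin 5 → ℝ) x →L[ℝ]
      (TangentSpace 𝓘(ℝ, Fin 5 → ℝ) x →L[ℝ] Bundle.Trivial (Nil Γ) ℝ x)) smoothSection_theta hs
  phi := SmoothSection.smul_param smoothSection_phi hc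

theorem analyticOnNhd_smul_const {F : Type*} [NormedAddCommGroup F] [NormedSpace ℝ F] {c : ℝ → ℝ}
    (hc : AnalyticOnNhd ℝ c Set.univ) (v : F) : AnalyticOnNhd ℝ (fun t => c t • v) Set.univ :=
  hc.smul analyticOnNhd_const

theorem analyticInParameter_interpolation {c s : ℝ → ℝ} (hc : AnalyticOnNhd ℝ c Set.univ)
    (hs : AnalyticOnNhd ℝ s Set.univ) :
    AnalyticInParameter (fun t => interpolation Γ (c t) (s t)) where
  F _ := analyticOnNhd_const
  eta _ := analyticOnNhd_const
  pi x := analyticOnNhd_smul_const (F := ((Fin 5 → ℝ) →L[ℝ] ℝ) →L[ℝ] (Fin 5 → ℝ)) hs ((J₁ Γ).pi x)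
  theta x := analyticOnNhd_smul_const (F := (Fin 5 → ℝ) →L[ℝ] (Fin 5 → ℝ) →L[ℝ] ℝ) hs
    ((J₁ Γ).theta x)
  phi x := analyticOnNhd_smul_const (F := (Fin 5 → ℝ) →L[ℝ] (Fin 5 → ℝ)) hc ((J₀ Γ).phi x)

theorem isGenContact_interpolation {c s : ℝ} (hcs : c ^ 2 + s ^ 2 = 1) :
    IsGenContact (interpolation Γ c s) where
  almost :=
    { smooth := smoothFamily_interpolation (c := fun _ => c) (s := fun _ => s) contDiff_const
        contDiff_const
      skew := interpolation_skew c s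
      eta_F := fun x => by
        have h := coframe_frame Γ 4 4 x
        rwa [if_pos rfl] at h
      Phi_F := interpolation_Phi_F c s
      Phi_eta := interpolation_Phi_eta c s
      Phi_Phi := interpolation_Phi_Phi hcs }
  closed := interpolation_courantClosed hcs

theorem interpolation_one_zero : interpolation Γ 1 0 = J₀ Γ := by
  ext1
  · rfl
  · rfl
  · funext x
    exact zero_smul ℝ ((J₁ Γ).pi x)
  · funext x
    ext1 X
    exact zero_smul ℝ ((J₁ Γ).theta x X)
  · funext x
    exact one_smul ℝ ((J₀ Γ).phi x)

theorem interpolation_zero_one : interpolation Γ 0 1 = J₁ Γ := by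
  ext1
  · rfl
  · rfl
  · funext x
    exact one_smul ℝ ((J₁ Γ).pi x)
  · funext x
    ext1 X
    exact one_smul ℝ ((J₁ Γ).theta x X)
  · funext x
    exact zero_smul ℝ ((J₀ Γ).phi x)

theorem Equivalent.refl (J : Tensors (E := Fin 5 → ℝ) (Nil Γ)) : Equivalent J J :=
  ⟨fun _ => 1, contMDiff_const, fun _ => one_ne_zero, rfl, rfl, rfl,
    fun _ => (one_smul ℝ _).symm, fun _ => by rw [inv_one, one_smul]⟩

variable (Γ) in
theorem sameDeformationFamily : SameDeformationFamily (J₀ Γ) (J₁ Γ) := by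
  -- The factor `π / 2` makes `t = 1` the end of the quarter turn, so both end members are reached
  -- exactly and the rescaling function can be `1`.
  let c : ℝ → ℝ := fun t => Real.cos (Real.pi / 2 * t)
  let s : ℝ → ℝ := fun t => Real.sin (Real.pi / 2 * t)
  have hlin : AnalyticOnNhd ℝ (fun t : ℝ => Real.pi / 2 * t) Set.univ :=
    analyticOnNhd_const.mul analyticOnNhd_id
  have hc : AnalyticOnNhd ℝ c Set.univ :=
    Real.analyticOnNhd_cos.comp hlin (Set.mapsTo_univ _ _)
  have hs : AnalyticOnNhd ℝ s Set.univ :=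
    Real.analyticOnNhd_sin.comp hlin (Set.mapsTo_univ _ _)
  refine ⟨fun t => interpolation Γ (c t) (s t),
    smoothFamily_interpolation (Real.contDiff_cos.comp (contDiff_const.mul contDiff_id))
      (Real.contDiff_sin.comp (contDiff_const.mul contDiff_id)),
    analyticInParameter_interpolation hc hs,
    fun t => isGenContact_interpolation (Real.cos_sq_add_sin_sq _), ?_, ?_⟩
  · have h : interpolation Γ (c 0) (s 0) = J₀ Γ := by simp [c, s, interpolation_one_zero]
    simp only [h]
    exact Equivalent.refl _
  · have h : interpolation Γ (c 1) (s 1) = J₁ Γ := by simp [c, s, interpolation_zero_one]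
    simp only [h]
    exact Equivalent.refl _

/-! ## The contact form -/

theorem theta_apply (x : Nil Γ) (X Y : TangentSpace 𝓘(ℝ, Fin 5 → ℝ) x) :
    (J₁ Γ).theta x X Y = (coframe Γ 0 x X * coframe Γ 2 x Y - coframe Γ 2 x X * coframe Γ 0 x Y)
      - (coframe Γ 1 x X * coframe Γ 3 x Y - coframe Γ 3 x X * coframe Γ 1 x Y) := rfl

theorem pi_apply (x : Nil Γ) (α : CotSpace (E := Fin 5 → ℝ) x) :
    (J₁ Γ).pi x α = (α (frame Γ 0 x) • frame Γ 2 x - α (frame Γ 2 x) • frame Γ 0 x)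
      - (α (frame Γ 1 x) • frame Γ 3 x - α (frame Γ 3 x) • frame Γ 1 x) := rfl

/-- `de⁵ = e¹ ∧ e³ - e² ∧ e⁴`. -/
theorem dForm_coframe_four (x : Nil Γ) : dForm (coframe Γ 4) x = (J₁ Γ).theta x := by
  ext X Y
  have hs : CoverSmooth (fcomp (coframe Γ 4)) := (smoothOneForm_coframe 4).coverSmooth
  -- The components of `e⁵` are constant, so in `dForm_triv` only the term `-e⁵([X, Y])` survives.
  have h0 : invDeriv (fcomp (coframe Γ 4)) x = 0 := by
    simp [invDeriv, fcomp_coframe]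
  have hX : X = triv Γ x ((trivEquiv Γ x).symm X) := by
    rw [← trivEquiv_apply, ContinuousLinearEquiv.apply_symm_apply]
  have hY : Y = triv Γ x ((trivEquiv Γ x).symm Y) := by
    rw [← trivEquiv_apply, ContinuousLinearEquiv.apply_symm_apply]
  have h := dForm_triv hs x ((trivEquiv Γ x).symm X) ((trivEquiv Γ x).symm Y)
  rw [← hX, ← hY, h0, fcomp_coframe] at h
  rw [theta_apply]
  simp only [coframe_apply]
  refine h.trans ?_
  simp [lieBr]
  ring

theorem isContactForm_coframe_four : IsContactForm (coframe Γ 4) where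
  smooth := smoothOneForm_coframe 4
  ne_zero x h := by
    have h1 := coframe_frame Γ 4 4 x
    rw [h] at h1
    simp at h1
  nondegenerate x X hX h := by
    apply tangent_ext
    intro i
    rw [map_zero]
    simp only [dForm_coframe_four, theta_apply] at h
    -- Up to sign, contracting `θ(X, ·)` with `e₃, e₄, e₁, e₂` reads off the first four components
    -- of `X`; the fifth is `η(X) = 0`.
    fin_cases i
    · simpa [coframe_frame] using h (frame Γ 2 x)
    · simpa [coframe_frame] using h (frame Γ 3 x)
    · simpa [coframe_frame] using h (frame Γ 0 x)
    · simpa [coframe_frame] using h (frame Γ 1 x)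
    · exact hX

theorem isAssociatedToContactForm_J₁ : IsAssociatedToContactForm (coframe Γ 4) (J₁ Γ) where
  eta_eq := rfl
  theta_eq := funext fun x => (dForm_coframe_four x).symm
  phi_eq := rfl
  eta_F x := by
    have h := coframe_frame Γ 4 4 x
    rwa [if_pos rfl] at h
  reeb x := by
    have hF : (J₁ Γ).F x = frame Γ 4 x := rfl
    rw [dForm_coframe_four, hF]
    ext Y
    rw [theta_apply]
    simp [coframe_frame]
  pi_flat x X Y := by
    -- The terms in `η` drop out: `π` involves only `e₁, …, e₄`, on which `η` vanishes. What remains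
    -- is that `π` inverts `θ` on their span, up to sign.
    rw [pi_apply]
    simp only [sub_apply, smul_apply, map_sub, map_smul, theta_apply, coframe_frame, smul_eq_mul]
    simp
    ring

end Deformation

end GenContact

end

theorem mainTheorem7 (Γ : Subgroup GenContact.G) [DiscreteTopology Γ]
    [CompactSpace (GenContact.Nil Γ)] :
    GenContact.IsContactForm (GenContact.coframe Γ 4) ∧
      GenContact.IsAssociatedToContactForm (GenContact.coframe Γ 4) (GenContact.J₁ Γ) ∧
      GenContact.SameDeformationFamily (GenContact.J₀ Γ) (GenContact.J₁ Γ) :=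
  ⟨GenContact.isContactForm_coframe_four, GenContact.isAssociatedToContactForm_J₁,
    GenContact.sameDeformationFamily Γ⟩
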